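/- Let $D=D[0,1]$ be the space of functions $x:[0,1]\to\mathbb R$ that are right continuous and have left-hand limits. Equip $D$ with the Skorokhod metric $$d(x,y)=\inf_{\lambda\in\Lambda}\Big\{\sup_{t}|\lambda t-t|\vee\sup_{t}|x(t)-y(\lambda t)|\Big\},$$ where $\Lambda$ is the class of strictly increasing continuous maps $\lambda:[0,1]\to[0,1]$ with $\lambda 0=0$, $\lambda 1=1$, and with the Borel $\sigma$-algebra of $d$. Let $X$ and $X^n$, $n\ge1$, be random elements of $D$, each defined on its own probability space, and write $\Rightarrow$ for convergence in distribution. Let $P$ be the distribution of $X$, and let $T_P\subset[0,1]$ be the set of those $t$ for which the projection $\pi_t:D\to\mathbb R$, $\pi_t(x)=x(t)$, is continuous at $P$-almost every $x\in D$. Suppose that (i) $(X^n_{t_1},\ldots,X^n_{t_k})\Rightarrow(X_{t_1},\ldots,X_{t_k})$ as $n\to\infty$ for all $k$ and all $t_1,\ldots,t_k\in T_P$; (ii) $X_1-X_{1-\delta}\Rightarrow 0$ as $\delta\downarrow0$; (iii) there exist $\alpha>1$, $\beta>0$ and a nondecreasing continuous function $H:[0,1]\to\mathbb R$ such that for all $n$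 and all $0\le r\le s\le t\le1$, $$\mathbb E\Big(|X^n_s-X^n_r|^\beta\,|X^n_t-X^n_s|^\beta\Big)\le (H(t)-H(r))^{\alpha}.$$ Then $X^n\Rightarrow X$ in $D$ as $n\to\infty$. -/

import Mathlib

open MeasureTheory Filter Topology

/-- The space `D = D[0,1]` of functions `x : [0,1] → ℝ` that are right continuous and have
left-hand limits. (Inside `[0,1]` the conditions are void for the right limit at `1` and the left
limit at `0`.) -/
structure Cadlag where
  toFun : unitInterval → ℝ
  right_continuous : ∀ t, ContinuousWithinAt toFun (Set.Ici t) t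
  left_limit : ∀ t, ∃ l : ℝ, Tendsto toFun (𝓝[<] t) (𝓝 l)

namespace Cadlag

instance : CoeFun Cadlag (fun _ => unitInterval → ℝ) := ⟨Cadlag.toFun⟩

theorem ext_fun {x y : Cadlag} (h : ∀ t, x t = y t) : x = y := by
  cases x; cases y; congr; exact funext h

/-- A cadlag function on `[0,1]` is bounded. -/
theorem exists_bound (x : Cadlag) : ∃ C : ℝ, ∀ t, |x t| ≤ C := by
  have key : ∃ C : ℝ, ∀ t ∈ (Set.univ : Set unitInterval), |x t| ≤ C := by
    refine isCompact_univ.induction_on (p := fun s => ∃ C : ℝ, ∀ t ∈ s, |x t| ≤ C)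
      ⟨0, by simp⟩ ?_ ?_ ?_
    · rintro s t hst ⟨C, hC⟩
      exact ⟨C, fun u hu => hC u (hst hu)⟩
    · rintro s t ⟨C, hC⟩ ⟨C', hC'⟩
      refine ⟨max C C', ?_⟩
      rintro u (hu | hu)
      · exact (hC u hu).trans (le_max_left _ _)
      · exact (hC' u hu).trans (le_max_right _ _)
    · intro t _
      obtain ⟨l, hl⟩ := x.left_limit t
      have h1 : ∀ᶠ s in 𝓝[<] t, |x s| ≤ |l| + 1 := by
        have := hl.abs.eventually (eventually_le_nhds (lt_add_one |l|))
        exact this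
      have h2 : ∀ᶠ s in 𝓝[≥] t, |x s| ≤ |x t| + 1 := by
        have h := x.right_continuous t
        exact (Filter.Tendsto.abs h).eventually (eventually_le_nhds (lt_add_one |x t|))
      refine ⟨{s | |x s| ≤ max (|l| + 1) (|x t| + 1)}, ?_, _, fun s hs => hs⟩
      rw [nhdsWithin_univ, ← nhdsLT_sup_nhdsGE]
      refine Filter.mem_sup.2 ⟨?_, ?_⟩
      · exact h1.mono fun s hs => hs.trans (le_max_left _ _)
      · exact h2.mono fun s hs => hs.trans (le_max_right _ _)
  obtain ⟨C, hC⟩ := key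
  exact ⟨C, fun t => hC t (Set.mem_univ t)⟩

/-- The value `‖λ - 1‖ ∨ ‖x - y ∘ λ‖` (sup norms) of a time change `λ`. The increasing
bijections of `[0,1]` are exactly the strictly increasing continuous maps `λ : [0,1] → [0,1]`
with `λ 0 = 0` and `λ 1 = 1`. -/
noncomputable def cost (x y : Cadlag) (lam : unitInterval ≃o unitInterval) : ℝ :=
  max (⨆ t, |(lam t : ℝ) - t|) (⨆ t, |x t - y (lam t)|)

theorem bdd_time (lam : unitInterval ≃o unitInterval) :
    BddAbove (Set.range fun t => |(lam t : ℝ) - t|) := by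
  refine ⟨1, ?_⟩
  rintro _ ⟨t, rfl⟩
  have h1 := (lam t).2
  have h2 := t.2
  exact abs_le.2 ⟨by linarith [h1.1, h2.2], by linarith [h1.2, h2.1]⟩

theorem bdd_space (x y : Cadlag) (lam : unitInterval ≃o unitInterval) :
    BddAbove (Set.range fun t => |x t - y (lam t)|) := by
  obtain ⟨C, hC⟩ := x.exists_bound
  obtain ⟨C', hC'⟩ := y.exists_bound
  refine ⟨C + C', ?_⟩
  rintro _ ⟨t, rfl⟩
  exact (abs_sub _ _).trans (add_le_add (hC _) (hC' _))

theorem cost_le_iff (x y : Cadlag) (lam : unitInterval ≃o unitInterval) (c : ℝ) :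
    cost x y lam ≤ c ↔ (∀ t, |(lam t : ℝ) - t| ≤ c) ∧ ∀ t, |x t - y (lam t)| ≤ c := by
  rw [cost, max_le_iff, ciSup_le_iff (bdd_time lam), ciSup_le_iff (bdd_space x y lam)]

theorem cost_nonneg (x y : Cadlag) (lam : unitInterval ≃o unitInterval) : 0 ≤ cost x y lam :=
  (abs_nonneg _).trans (((cost_le_iff x y lam _).1 le_rfl).1 0)

/-- The Skorokhod distance `d(x, y) = inf_λ (‖λ - 1‖ ∨ ‖x - y ∘ λ‖)`. -/
noncomputable def skorokhodDist (x y : Cadlag) : ℝ :=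
  ⨅ lam : unitInterval ≃o unitInterval, cost x y lam

theorem bdd_cost (x y : Cadlag) : BddBelow (Set.range (cost x y)) :=
  ⟨0, by rintro _ ⟨lam, rfl⟩; exact cost_nonneg x y lam⟩

theorem dist_le_of (x y : Cadlag) (lam : unitInterval ≃o unitInterval) {c : ℝ}
    (h1 : ∀ t, |(lam t : ℝ) - t| ≤ c) (h2 : ∀ t, |x t - y (lam t)| ≤ c) :
    skorokhodDist x y ≤ c :=
  (ciInf_le (bdd_cost x y) lam).trans ((cost_le_iff x y lam c).2 ⟨h1, h2⟩)

theorem exists_of_dist_lt {x y : Cadlag} {c : ℝ} (h : skorokhodDist x y < c) :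
    ∃ lam : unitInterval ≃o unitInterval,
      (∀ t, |(lam t : ℝ) - t| ≤ c) ∧ ∀ t, |x t - y (lam t)| ≤ c := by
  obtain ⟨lam, hlam⟩ := exists_lt_of_ciInf_lt h
  exact ⟨lam, (cost_le_iff x y lam c).1 hlam.le⟩

theorem dist_nonneg' (x y : Cadlag) : 0 ≤ skorokhodDist x y := le_ciInf (cost_nonneg x y)

theorem dist_self' (x : Cadlag) : skorokhodDist x x = 0 :=
  le_antisymm (dist_le_of x x (OrderIso.refl _) (by simp) (by simp)) (dist_nonneg' x x)

theorem dist_comm_le (x y : Cadlag) : skorokhodDist x y ≤ skorokhodDist y x := by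
  refine le_of_forall_gt_imp_ge_of_dense fun c hc => ?_
  obtain ⟨lam, h1, h2⟩ := exists_of_dist_lt hc
  refine dist_le_of x y lam.symm (fun t => ?_) (fun t => ?_)
  · simpa [abs_sub_comm] using h1 (lam.symm t)
  · simpa [abs_sub_comm] using h2 (lam.symm t)

theorem dist_triangle' (x y z : Cadlag) :
    skorokhodDist x z ≤ skorokhodDist x y + skorokhodDist y z := by
  refine le_of_forall_pos_le_add fun e he => ?_
  obtain ⟨l1, h1, h2⟩ := exists_of_dist_lt (lt_add_of_pos_right (skorokhodDist x y) (half_pos he))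
  obtain ⟨l2, k1, k2⟩ := exists_of_dist_lt (lt_add_of_pos_right (skorokhodDist y z) (half_pos he))
  refine dist_le_of x z (l1.trans l2) (fun t => ?_) (fun t => ?_)
  · have := abs_sub_le (l2 (l1 t) : ℝ) (l1 t) t
    have a := h1 t
    have b := k1 (l1 t)
    simp only [OrderIso.trans_apply]
    linarith
  · have := abs_sub_le (x t) (y (l1 t)) (z (l2 (l1 t)))
    have a := h2 t
    have b := k2 (l1 t)
    simp only [OrderIso.trans_apply]
    linarith

theorem eq_of_dist_eq_zero' {x y : Cadlag} (h : skorokhodDist x y = 0) : x = y := by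
  refine ext_fun fun t => ?_
  refine eq_of_abs_sub_le_all fun e he => ?_
  rcases eq_or_lt_of_le (show t ≤ 1 from t.2.2) with rfl | ht
  · obtain ⟨lam, -, h2⟩ := exists_of_dist_lt (h.trans_lt he)
    have : lam 1 = 1 := lam.map_top
    simpa [this] using h2 1
  · have hx : ∀ᶠ s in 𝓝[≥] t, |x s - x t| < e / 3 := by
      have := (x.right_continuous t).eventually (Metric.ball_mem_nhds _ (by positivity : 0 < e / 3))
      simpa [Real.dist_eq] using this
    have hy : ∀ᶠ s in 𝓝[≥] t, |y s - y t| < e / 3 := by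
      have := (y.right_continuous t).eventually (Metric.ball_mem_nhds _ (by positivity : 0 < e / 3))
      simpa [Real.dist_eq] using this
    obtain ⟨u, htu, hu⟩ := (mem_nhdsGE_iff_exists_Ico_subset' ht).1 (hx.and hy)
    obtain ⟨s, hts, hsu⟩ := exists_between (show t < u from htu)
    have hts' : (t : ℝ) < s := hts
    have hsu' : (s : ℝ) < u := hsu
    set c : ℝ := min (e / 3) (min (((s : ℝ) - t) / 2) (((u : ℝ) - s) / 2)) with hc
    have hcpos : 0 < c := by
      refine lt_min (by positivity) (lt_min ?_ ?_) <;> linarith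
    obtain ⟨lam, h1, h2⟩ := exists_of_dist_lt (h.trans_lt hcpos)
    have c1 : c ≤ e / 3 := min_le_left _ _
    have c2 : c ≤ ((s : ℝ) - t) / 2 := (min_le_right _ _).trans (min_le_left _ _)
    have c3 : c ≤ ((u : ℝ) - s) / 2 := (min_le_right _ _).trans (min_le_right _ _)
    have hl := abs_le.1 (h1 s)
    have m1 : (t : ℝ) ≤ lam s := by linarith [hl.1]
    have m2 : (lam s : ℝ) < u := by linarith [hl.2]
    have a1 := (abs_lt.1 (hu (show s ∈ Set.Ico t u from ⟨hts.le, hsu⟩)).1)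
    have a2 := (abs_lt.1 (hu (show lam s ∈ Set.Ico t u from ⟨m1, m2⟩)).2)
    have a3 := abs_le.1 (h2 s)
    exact abs_le.2 ⟨by linarith [a1.1, a1.2, a2.1, a2.2, a3.1, a3.2],
      by linarith [a1.1, a1.2, a2.1, a2.2, a3.1, a3.2]⟩

/-- The metric `d`, which induces the Skorokhod topology on `D[0,1]`. -/
noncomputable instance : MetricSpace Cadlag where
  dist := skorokhodDist
  dist_self := dist_self'
  dist_comm x y := le_antisymm (dist_comm_le x y) (dist_comm_le y x)
  dist_triangle := dist_triangle'
  eq_of_dist_eq_zero := eq_of_dist_eq_zero'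

/-- `D[0,1]` carries the Borel σ-algebra of the Skorokhod topology. -/
noncomputable instance : MeasurableSpace Cadlag := borel Cadlag

instance : BorelSpace Cadlag := ⟨rfl⟩

/-- `T_P`: the times `t` at which the projection `π_t : x ↦ x(t)` is continuous (for the
Skorokhod topology) at `P`-almost every `x`. -/
def contTimes (P : Measure Cadlag) : Set unitInterval :=
  {t | ∀ᵐ x ∂P, ContinuousAt (fun y : Cadlag => y t) x}

end Cadlag

open MeasureTheory Filter Topology

/-! The proof compares every process with its step-function discretization along a grid, so no
tightness argument is needed. Fix a bounded Lipschitz `f` and grids with points in `T_P` and mesh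
tending to zero. Three comparisons give the limit of the integrals of `f`.

For one grid, the discretization is a continuous function of finitely many coordinates
(`continuous_stepVec`), so (i) gives convergence of the discretized processes. For the limit
process, discretizations converge pathwise (`tendsto_discretize`), hence in mean by dominated
convergence. For `X^n` the error must be small uniformly in large `n`, which is where (iii) and (ii)
enter.

If on a grid interval one of any two consecutive increments is at most `ε`, the path makes
essentially one move there: it stays near its initial value up to a change point and near its final
value afterwards (`exists_changePoint`). A time change carrying grid points to change points then
aligns the discretization with the path (`dist_discretize_le`). Only the last interval resists,
since a time change fixes `1`; there the increment up to `1` must be small, which (ii) ensures for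
the limit and (i) transfers to `X^n`.

The probability that the triple oscillation on `[a, b]` exceeds `ε` is at most a constant times `(H
b - H a) ^ α`, by dyadic chaining from (iii) (`measure_not_smallTripleOsc_le`). As `α > 1`, the sum
of these bounds over a grid tends to zero with its mesh. -/

/-- On `[a, b]`, of any two consecutive increments of `x` one has absolute value at most `ε`. -/
def SmallTripleOsc (x : unitInterval → ℝ) (a b : unitInterval) (ε : ℝ) : Prop :=
  ∀ r s t, a ≤ r → r ≤ s → s ≤ t → t ≤ b → |x s - x r| ≤ ε ∨ |x t - x s| ≤ ε

/-! ### Partitions, piecewise linear time changes and step functions -/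

/-- A partition `0 = t₀ < t₁ < ⋯ < tₖ = 1` of the unit interval. -/
structure TimeGrid (k : ℕ) where
  pts : ℕ → unitInterval
  zero : pts 0 = 0
  last : pts k = 1
  lt_succ : ∀ i < k, pts i < pts (i + 1)

namespace TimeGrid

variable {k : ℕ}

theorem pts_lt (σ : TimeGrid k) {i j : ℕ} (hij : i < j) (hj : j ≤ k) : σ.pts i < σ.pts j := by
  induction j, hij using Nat.le_induction with
  | base => exact σ.lt_succ i (by omega)
  | succ j hij ih => exact (ih (by omega)).trans (σ.lt_succ j (by omega))

theorem pts_le (σ : TimeGrid k) {i j : ℕ} (hij : i ≤ j) (hj : j ≤ k) : σ.pts i ≤ σ.pts j := by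
  rcases hij.eq_or_lt with rfl | h
  · exact le_rfl
  · exact (σ.pts_lt h hj).le

theorem exists_mem_Ico (σ : TimeGrid k) {u : unitInterval} (hu : u < 1) :
    ∃ j < k, σ.pts j ≤ u ∧ u < σ.pts (j + 1) := by
  classical
  have hex : ∃ j, u < σ.pts j := ⟨k, by rwa [σ.last]⟩
  have h1 := Nat.find_spec hex
  have h2 : Nat.find hex ≤ k := Nat.find_min' hex (by rwa [σ.last])
  obtain ⟨j, hj⟩ : ∃ j, Nat.find hex = j + 1 := by
    refine Nat.exists_eq_succ_of_ne_zero fun h0 => ?_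
    rw [h0, σ.zero] at h1
    exact absurd h1 (not_lt.2 u.2.1)
  refine ⟨j, by omega, ?_, hj ▸ h1⟩
  exact not_lt.1 (Nat.find_min hex (show j < Nat.find hex by omega))

/-- The piecewise linear function with value `τ.pts i` at `σ.pts i`. -/
noncomputable def interp (σ τ : TimeGrid k) (u : ℝ) : ℝ :=
  ∑ j ∈ Finset.range k, ((τ.pts (j + 1) : ℝ) - τ.pts j) *
    max 0 (min 1 ((u - σ.pts j) / ((σ.pts (j + 1) : ℝ) - σ.pts j)))

/-- At a grid point every ramp is either full or empty, so the sum telescopes. -/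
theorem interp_pts (σ τ : TimeGrid k) {i : ℕ} (hi : i ≤ k) :
    interp σ τ (σ.pts i) = τ.pts i := by
  have key : ∀ j ∈ Finset.range k, ((τ.pts (j + 1) : ℝ) - τ.pts j) *
      max 0 (min 1 (((σ.pts i : ℝ) - σ.pts j) / ((σ.pts (j + 1) : ℝ) - σ.pts j)))
      = if j < i then ((τ.pts (j + 1) : ℝ) - τ.pts j) else 0 := by
    intro j hj
    have hjk := Finset.mem_range.1 hj
    have hpos : (0 : ℝ) < (σ.pts (j + 1) : ℝ) - σ.pts j := sub_pos.2 (σ.lt_succ j hjk)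
    split_ifs with hji
    · have h1 : (σ.pts (j + 1) : ℝ) ≤ σ.pts i := σ.pts_le hji hi
      rw [min_eq_left, max_eq_right zero_le_one, mul_one]
      rw [le_div_iff₀ hpos]; linarith
    · have h1 : (σ.pts i : ℝ) ≤ σ.pts j := σ.pts_le (not_lt.1 hji) hjk.le
      rw [max_eq_left, mul_zero]
      exact (min_le_right _ _).trans (div_nonpos_of_nonpos_of_nonneg (by linarith) hpos.le)
  rw [interp, Finset.sum_congr rfl key, ← Finset.sum_filter]
  have : (Finset.range k).filter (fun j => j < i) = Finset.range i := by
    ext j; simp only [Finset.mem_filter, Finset.mem_range]; omega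
  rw [this, Finset.sum_range_sub (fun j => (τ.pts j : ℝ)) i, τ.zero]
  simp

theorem continuous_interp (σ τ : TimeGrid k) : Continuous (interp σ τ) := by
  unfold interp
  refine continuous_finsetSum _ fun j _ => ?_
  exact continuous_const.mul (continuous_const.max (continuous_const.min
    ((continuous_id.sub continuous_const).div_const _)))

/-- No ramp decreases, and the ramp of the interval containing `u` increases strictly. -/
theorem interp_lt (σ τ : TimeGrid k) {u v : unitInterval} (huv : u < v) :
    interp σ τ u < interp σ τ v := by
  obtain ⟨j, hjk, hj1, hj2⟩ := σ.exists_mem_Ico (huv.trans_le v.2.2)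
  have huv' : (u : ℝ) < v := huv
  refine Finset.sum_lt_sum (fun i hi => ?_) ⟨j, Finset.mem_range.2 hjk, ?_⟩
  · have hik := Finset.mem_range.1 hi
    have hpos : (0 : ℝ) < (σ.pts (i + 1) : ℝ) - σ.pts i := sub_pos.2 (σ.lt_succ i hik)
    have hpos' : (0 : ℝ) < (τ.pts (i + 1) : ℝ) - τ.pts i := sub_pos.2 (τ.lt_succ i hik)
    gcongr
  · have hpos : (0 : ℝ) < (σ.pts (j + 1) : ℝ) - σ.pts j := sub_pos.2 (σ.lt_succ j hjk)
    have hpos' : (0 : ℝ) < (τ.pts (j + 1) : ℝ) - τ.pts j := sub_pos.2 (τ.lt_succ j hjk)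
    have hj1' : (σ.pts j : ℝ) ≤ u := hj1
    have hj2' : (u : ℝ) < σ.pts (j + 1) := hj2
    have hnn : 0 ≤ ((u : ℝ) - σ.pts j) / ((σ.pts (j + 1) : ℝ) - σ.pts j) :=
      div_nonneg (by linarith) hpos.le
    have hlt : ((u : ℝ) - σ.pts j) / ((σ.pts (j + 1) : ℝ) - σ.pts j) < 1 := by
      rw [div_lt_one hpos]; linarith
    refine mul_lt_mul_of_pos_left ?_ hpos'
    rw [min_eq_right hlt.le, max_eq_right hnn]
    refine lt_max_of_lt_right (lt_min hlt ?_)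
    gcongr

/-- Two partitions with the same number of points are matched by an increasing bijection. -/
theorem exists_orderIso (σ τ : TimeGrid k) :
    ∃ lam : unitInterval ≃o unitInterval, ∀ i ≤ k, lam (σ.pts i) = τ.pts i := by
  have h0 : interp σ τ (0 : unitInterval) = (0 : unitInterval) := by
    simpa only [σ.zero, τ.zero] using interp_pts σ τ (Nat.zero_le k)
  have h1 : interp σ τ (1 : unitInterval) = (1 : unitInterval) := by
    simpa only [σ.last, τ.last] using interp_pts σ τ le_rfl
  have hmono : StrictMono fun u : unitInterval => interp σ τ u := fun u v huv => interp_lt σ τ huv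
  have hmem : ∀ u : unitInterval, interp σ τ u ∈ unitInterval := fun u =>
    ⟨by simpa using h0.symm.le.trans (hmono.monotone (show 0 ≤ u from u.2.1)),
     by simpa using (hmono.monotone (show u ≤ 1 from u.2.2)).trans h1.le⟩
  have hsurj : Function.Surjective fun u : unitInterval =>
      (⟨interp σ τ u, hmem u⟩ : unitInterval) := by
    intro v
    have hv : (v : ℝ) ∈ Set.Icc (interp σ τ 0) (interp σ τ 1) := by
      have e0 : interp σ τ 0 = 0 := by simpa using h0
      have e1 : interp σ τ 1 = 1 := by simpa using h1
      rw [e0, e1]; exact v.2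
    obtain ⟨u, hu, huv⟩ :=
      intermediate_value_Icc zero_le_one (continuous_interp σ τ).continuousOn hv
    exact ⟨⟨u, hu⟩, Subtype.ext huv⟩
  have hmono' : StrictMono fun u : unitInterval => (⟨interp σ τ u, hmem u⟩ : unitInterval) :=
    fun u v huv => hmono huv
  exact ⟨hmono'.orderIsoOfSurjective _ hsurj, fun i hi => Subtype.ext (interp_pts σ τ hi)⟩

/-- The mesh of the partition is at most `δ`. -/
def MeshLE (σ : TimeGrid k) (δ : ℝ) : Prop :=
  ∀ i < k, (σ.pts (i + 1) : ℝ) - σ.pts i ≤ δ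

/-- The step function that takes the value `y i` on `[tᵢ, tᵢ₊₁)` and `y k` at `1`. -/
noncomputable def stepFun (σ : TimeGrid k) (y : ℕ → ℝ) (u : unitInterval) : ℝ :=
  y 0 + ∑ i ∈ Finset.range k, (y (i + 1) - y i) * if σ.pts (i + 1) ≤ u then 1 else 0

theorem stepFun_eq (σ : TimeGrid k) (y : ℕ → ℝ) {u : unitInterval} {j : ℕ} (hjk : j ≤ k)
    (h : ∀ i < k, σ.pts (i + 1) ≤ u ↔ i < j) : σ.stepFun y u = y j := by
  have key : ∀ i ∈ Finset.range k, ((y (i + 1) - y i) * if σ.pts (i + 1) ≤ u then 1 else 0)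
      = if i < j then y (i + 1) - y i else 0 := by
    intro i hi
    simp only [h i (Finset.mem_range.1 hi), mul_ite, mul_one, mul_zero]
  rw [stepFun, Finset.sum_congr rfl key, ← Finset.sum_filter]
  have : (Finset.range k).filter (fun i => i < j) = Finset.range j := by
    ext i; simp only [Finset.mem_filter, Finset.mem_range]; omega
  rw [this, Finset.sum_range_sub y j]
  ring

theorem stepFun_eq_of_mem_Ico (σ : TimeGrid k) (y : ℕ → ℝ) {u : unitInterval} {j : ℕ}
    (hjk : j < k) (h1 : σ.pts j ≤ u) (h2 : u < σ.pts (j + 1)) : σ.stepFun y u = y j := by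
  refine σ.stepFun_eq y hjk.le fun i hi => ⟨fun h => ?_, fun h => ?_⟩
  · by_contra hij
    exact absurd (h.trans_lt h2) (not_lt.2 (σ.pts_le (by omega) (by omega)))
  · exact (σ.pts_le h hjk.le).trans h1

theorem stepFun_one (σ : TimeGrid k) (y : ℕ → ℝ) : σ.stepFun y 1 = y k :=
  σ.stepFun_eq y le_rfl fun _ hi => ⟨fun _ => hi, fun _ => unitInterval.le_one'⟩

/-- The càdlàg step function with value `y i` on `[tᵢ, tᵢ₊₁)` and `y k` at `1`. -/
noncomputable def step (σ : TimeGrid k) (y : ℕ → ℝ) : Cadlag where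
  toFun := σ.stepFun y
  right_continuous t := by
    refine continuousWithinAt_const.add (tendsto_finsetSum _ fun i _ => ?_)
    refine tendsto_const_nhds.mul (tendsto_nhds_of_eventually_eq ?_)
    by_cases h : σ.pts (i + 1) ≤ t
    · filter_upwards [self_mem_nhdsWithin] with s hs
      rw [if_pos h, if_pos (h.trans hs)]
    · filter_upwards [mem_nhdsWithin_of_mem_nhds (Iio_mem_nhds (not_le.1 h))] with s hs
      rw [if_neg h, if_neg (not_le.2 hs)]
  left_limit t := by
    refine ⟨_, tendsto_const_nhds.add (tendsto_finsetSum _ fun i _ =>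
      tendsto_const_nhds.mul (tendsto_nhds_of_eventually_eq
        (x := if σ.pts (i + 1) < t then 1 else 0) ?_))⟩
    by_cases h : σ.pts (i + 1) < t
    · filter_upwards [mem_nhdsWithin_of_mem_nhds (Ioi_mem_nhds h)] with s hs
      rw [if_pos h, if_pos (le_of_lt hs)]
    · filter_upwards [self_mem_nhdsWithin] with s hs
      rw [if_neg h, if_neg (not_le.2 ((show s < t from hs).trans_le (not_lt.1 h)))]

/-- The step function that interpolates a vector `y` of values at the points of the partition. -/
noncomputable def stepVec (σ : TimeGrid k) (y : Fin (k + 1) → ℝ) : Cadlag :=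
  -- `Fin.ofNat` reduces modulo `k + 1`; this is harmless because `step` reads only the indices up
  -- to `k`.
  σ.step fun i => y (Fin.ofNat (k + 1) i)

theorem stepFun_sub_le (σ : TimeGrid k) (y z : ℕ → ℝ) {c : ℝ}
    (h : ∀ i ≤ k, |y i - z i| ≤ c) (u : unitInterval) :
    |σ.stepFun y u - σ.stepFun z u| ≤ c := by
  rcases eq_or_lt_of_le (show u ≤ 1 from u.2.2) with rfl | hu
  · rw [stepFun_one, stepFun_one]; exact h k le_rfl
  · obtain ⟨j, hjk, h1, h2⟩ := σ.exists_mem_Ico hu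
    rw [σ.stepFun_eq_of_mem_Ico y hjk h1 h2, σ.stepFun_eq_of_mem_Ico z hjk h1 h2]
    exact h j hjk.le

theorem continuous_stepVec (σ : TimeGrid k) : Continuous σ.stepVec := by
  refine (LipschitzWith.mk_one fun y z => ?_).continuous
  refine Cadlag.dist_le_of _ _ (OrderIso.refl _) (fun t => by simp [dist_nonneg]) fun t => ?_
  exact σ.stepFun_sub_le _ _ (fun i _ => dist_le_pi_dist y z _) t

/-- The discretization of a càdlàg function along a partition. -/
noncomputable def discretize (σ : TimeGrid k) (x : Cadlag) : Cadlag :=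
  σ.stepVec fun i => x (σ.pts i)

theorem discretize_apply (σ : TimeGrid k) (x : Cadlag) (u : unitInterval) :
    σ.discretize x u = σ.stepFun (fun i => x (σ.pts (Fin.ofNat (k + 1) i))) u := rfl

theorem discretize_one (σ : TimeGrid k) (x : Cadlag) : σ.discretize x 1 = x 1 := by
  rw [discretize_apply, σ.stepFun_one]
  simp only [Fin.ofNat, Nat.mod_eq_of_lt (Nat.lt_succ_self k), σ.last]

theorem discretize_of_mem_Ico (σ : TimeGrid k) (x : Cadlag) {u : unitInterval} {j : ℕ}
    (hjk : j < k) (h1 : σ.pts j ≤ u) (h2 : u < σ.pts (j + 1)) :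
    σ.discretize x u = x (σ.pts j) := by
  rw [discretize_apply, σ.stepFun_eq_of_mem_Ico _ hjk h1 h2]
  simp only [Fin.ofNat, Nat.mod_eq_of_lt (show j < k + 1 by omega)]

end TimeGrid

/-! ### Discretization error in the Skorokhod metric -/

namespace Cadlag

/-- Take for `c` the first time at which `x` has moved more than `ε` from `x a`. If `v` is a time of
such a move, all increments after `v` starting at `v` are at most `ε`, so later values are within `2
* ε` of `x b`. Right continuity gives `a < c` and extends the bound to `c` itself. -/
theorem exists_changePoint (x : Cadlag) {a b : unitInterval} (hab : a < b) {ε : ℝ} (hε : 0 < ε)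
    (h : SmallTripleOsc x a b ε) :
    ∃ c, a < c ∧ c ≤ b ∧ (∀ u, a ≤ u → u < c → |x u - x a| ≤ ε) ∧
      ∀ u, c ≤ u → u ≤ b → |x u - x b| ≤ 2 * ε := by
  -- Inserting `b` forces `c ≤ b` even when `x` never moves away from `x a`.
  set S : Set unitInterval := insert b {t | a ≤ t ∧ t ≤ b ∧ ε < |x t - x a|} with hS
  have hbS : b ∈ S := Set.mem_insert _ _
  have hcb : sInf S ≤ b := sInf_le hbS
  have hlate : ∀ u, sInf S < u → u ≤ b → |x u - x b| ≤ 2 * ε := by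
    intro u hu hub
    obtain ⟨v, hv, hvu⟩ := sInf_lt_iff.1 hu
    rcases hv with rfl | ⟨hav, hvb, hv⟩
    · exact absurd hvu (not_lt.2 hub)
    have e1 := (h a v u le_rfl hav hvu.le hub).resolve_left (not_le.2 hv)
    have e2 := (h a v b le_rfl hav hvb le_rfl).resolve_left (not_le.2 hv)
    have := abs_sub_le (x u) (x v) (x b)
    rw [abs_sub_comm (x v) (x b)] at this
    linarith
  refine ⟨sInf S, ?_, hcb, ?_, ?_⟩
  · have hx : ∀ᶠ s in 𝓝[≥] a, |x s - x a| < ε := by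
      have := (x.right_continuous a).eventually (Metric.ball_mem_nhds _ hε)
      simpa [Real.dist_eq] using this
    obtain ⟨u, hau, hu⟩ := (mem_nhdsGE_iff_exists_Ico_subset' hab).1 hx
    refine (lt_min hau hab).trans_le (le_sInf ?_)
    rintro t (rfl | ⟨hat, htb, ht⟩)
    · exact min_le_right _ _
    · refine (min_le_left _ _).trans (not_lt.1 fun htu => ?_)
      exact absurd (hu (show t ∈ Set.Ico a u from ⟨hat, htu⟩)) (not_lt.2 ht.le)
  · intro u hau huc
    by_contra hu
    exact absurd (sInf_le (show u ∈ S from Or.inr ⟨hau, huc.le.trans hcb, not_le.1 hu⟩))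
      (not_le.2 huc)
  · intro u hcu hub
    rcases hcu.lt_or_eq with hlt | rfl
    · exact hlate u hlt hub
    rcases hub.lt_or_eq with hlt | heq
    · have ht : Tendsto (fun u => |x u - x b|) (𝓝[>] sInf S) (𝓝 |x (sInf S) - x b|) :=
        (((x.right_continuous (sInf S)).mono_left
          (nhdsWithin_mono _ Set.Ioi_subset_Ici_self)).sub_const _).abs
      have : (𝓝[>] sInf S).NeBot := nhdsGT_neBot_of_exists_gt ⟨b, hlt⟩
      refine le_of_tendsto ht ?_
      filter_upwards [Ioo_mem_nhdsGT hlt] with v hv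
      exact hlate v hv.1 hv.2.le
    · rw [heq]; simp [hε.le]

/-- A partition on whose intervals `x` has small triple oscillation, and on whose last interval
`x` is nearly constant except at `1`, discretizes `x` well in the Skorokhod metric. -/
theorem dist_discretize_le {k : ℕ} (σ : TimeGrid (k + 1)) (x : Cadlag) {δ ε : ℝ} (hε : 0 < ε)
    (hσ : σ.MeshLE δ)
    (hosc : ∀ i < k + 1, SmallTripleOsc x (σ.pts i) (σ.pts (i + 1)) ε)
    (hend : ∀ u, σ.pts k ≤ u → u < 1 → |x u - x (σ.pts k)| ≤ 2 * ε) :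
    dist (σ.discretize x) x ≤ max (2 * δ) (2 * ε) := by
  have hex : ∀ i, ∃ c, i < k + 1 → σ.pts i < c ∧ c ≤ σ.pts (i + 1) ∧
      (∀ u, σ.pts i ≤ u → u < c → |x u - x (σ.pts i)| ≤ 2 * ε) ∧
      (i < k → ∀ u, c ≤ u → u ≤ σ.pts (i + 1) → |x u - x (σ.pts (i + 1))| ≤ 2 * ε) ∧
      (i = k → c = 1) := by
    intro i
    by_cases hi : i < k + 1
    · by_cases hik : i = k
      · subst hik
        refine ⟨1, fun _ => ⟨?_, ?_, hend, fun h => absurd h (lt_irrefl _), fun _ => rfl⟩⟩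
        · rw [← σ.last]; exact σ.lt_succ _ hi
        · rw [σ.last]
      · obtain ⟨c, h1, h2, h3, h4⟩ := x.exists_changePoint (σ.lt_succ i hi) hε (hosc i hi)
        exact ⟨c, fun _ => ⟨h1, h2, fun u a b => (h3 u a b).trans (by linarith), fun _ => h4,
          fun h => absurd h hik⟩⟩
    · exact ⟨0, fun h => absurd h hi⟩
  choose c hc using hex
  -- The image grid is `0, c 0, …, c k`, which is why the last change point had to be `1`.
  obtain ⟨τ, hτ⟩ : ∃ τ : TimeGrid (k + 1), ∀ i, τ.pts (i + 1) = c i := by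
    refine ⟨{ pts := fun i => Nat.casesOn i 0 c
              zero := rfl
              last := (hc k (Nat.lt_succ_self k)).2.2.2.2 rfl
              lt_succ := ?_ }, fun i => rfl⟩
    intro i hi
    cases i with
    | zero => exact (σ.zero ▸ (hc 0 hi).1 : (0 : unitInterval) < c 0)
    | succ i => exact (hc i (by omega)).2.1.trans_lt (hc (i + 1) hi).1
  have hτle : ∀ i ≤ k + 1, τ.pts i ≤ σ.pts i := by
    intro i hi
    cases i with
    | zero => rw [τ.zero, σ.zero]
    | succ i => rw [hτ]; exact (hc i (by omega)).2.1
  obtain ⟨lam, hlam⟩ := σ.exists_orderIso τ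
  have hδ : 0 ≤ δ := by
    have a1 : (σ.pts 0 : ℝ) < σ.pts (0 + 1) := σ.lt_succ 0 (by omega)
    have a2 := hσ 0 (by omega)
    linarith
  have hlam1 : lam 1 = 1 := lam.map_top
  refine dist_le_of _ _ lam (fun u => ?_) fun u => ?_
  · refine le_max_of_le_left ?_
    rcases eq_or_lt_of_le (show u ≤ 1 from u.2.2) with rfl | hu
    · rw [hlam1]; simpa using hδ
    obtain ⟨j, hjk, h1, h2⟩ := σ.exists_mem_Ico hu
    have l1 : τ.pts j ≤ lam u := hlam j hjk.le ▸ lam.monotone h1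
    have l2 : lam u ≤ τ.pts (j + 1) := hlam (j + 1) hjk ▸ lam.monotone h2.le
    have l3 := l2.trans (hτle (j + 1) hjk)
    have m1 := hσ j hjk
    -- A change point lies in the interval preceding its grid point, so it lags by at most one mesh;
    -- adding the length of the interval of `u` gives `2 * δ`.
    have l4 : (σ.pts j : ℝ) - δ ≤ τ.pts j := by
      cases j with
      | zero =>
        have : τ.pts 0 = σ.pts 0 := τ.zero.trans σ.zero.symm
        rw [this]; linarith
      | succ i =>
        have a1 : (σ.pts i : ℝ) ≤ c i := (hc i (by omega)).1.le
        have a2 := hσ i (by omega)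
        rw [hτ]
        linarith
    have r1 : (σ.pts j : ℝ) ≤ u := h1
    have r2 : (u : ℝ) ≤ σ.pts (j + 1) := h2.le
    have r3 : (τ.pts j : ℝ) ≤ lam u := l1
    have r4 : (lam u : ℝ) ≤ σ.pts (j + 1) := l3
    exact abs_le.2 ⟨by linarith, by linarith⟩
  · refine le_max_of_le_right ?_
    rcases eq_or_lt_of_le (show u ≤ 1 from u.2.2) with rfl | hu
    · rw [hlam1, σ.discretize_one]; simpa using hε.le
    obtain ⟨j, hjk, h1, h2⟩ := σ.exists_mem_Ico hu
    have l1 : τ.pts j ≤ lam u := hlam j hjk.le ▸ lam.monotone h1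
    have l2 : lam u < c j := hτ j ▸ hlam (j + 1) hjk ▸ lam.strictMono h2
    rw [σ.discretize_of_mem_Ico x hjk h1 h2, abs_sub_comm]
    -- `lam u` lies between the change points on either side of `σ.pts j`: after the grid point the
    -- path has not yet left `x (σ.pts j)`, before it the path has already arrived there.
    rcases le_total (σ.pts j) (lam u) with hle | hle
    · exact (hc j hjk).2.2.1 _ hle l2
    · cases j with
      | zero =>
        have e : lam u = σ.pts 0 := le_antisymm hle (by rw [σ.zero]; exact unitInterval.nonneg')
        rw [e]; simpa using hε.le
      | succ i => exact (hc i (by omega)).2.2.2.1 (by omega) _ (hτ i ▸ l1) hle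

/-- Triple oscillations of a càdlàg function over short intervals are small. -/
theorem exists_smallTripleOsc (x : Cadlag) {ε : ℝ} (hε : 0 < ε) :
    ∃ δ > 0, ∀ a b : unitInterval, (b : ℝ) - a < δ → SmallTripleOsc x a b ε := by
  have hloc : ∀ t : unitInterval, ∃ U, IsOpen U ∧ t ∈ U ∧ ∀ r ∈ U, ∀ s ∈ U, ∀ v ∈ U,
      r ≤ s → s ≤ v → |x s - x r| ≤ ε ∨ |x v - x s| ≤ ε := by
    intro t
    obtain ⟨l, hl⟩ := x.left_limit t
    have h1 : ∀ᶠ s in 𝓝[<] t, |x s - l| < ε / 2 := by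
      simpa [Real.dist_eq] using hl.eventually (Metric.ball_mem_nhds _ (half_pos hε))
    have h2 : ∀ᶠ s in 𝓝[≥] t, |x s - x t| < ε / 2 := by
      simpa [Real.dist_eq] using
        (x.right_continuous t).eventually (Metric.ball_mem_nhds _ (half_pos hε))
    have h3 : ∀ᶠ s in 𝓝 t, (s < t → |x s - l| < ε / 2) ∧ (t ≤ s → |x s - x t| < ε / 2) :=
      (eventually_nhdsWithin_iff.1 h1).and (eventually_nhdsWithin_iff.1 h2)
    obtain ⟨U, hU, hUo, htU⟩ := eventually_nhds_iff.1 h3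
    refine ⟨U, hUo, htU, fun r hr s hs v hv hrs hsv => ?_⟩
    -- The side of `t` on which the middle point lies decides which increment avoids the jump at
    -- `t`.
    rcases lt_or_ge s t with hst | hst
    · left
      have a1 := abs_lt.1 ((hU s hs).1 hst)
      have a2 := abs_lt.1 ((hU r hr).1 (hrs.trans_lt hst))
      exact abs_le.2 ⟨by linarith, by linarith⟩
    · right
      have a1 := abs_lt.1 ((hU s hs).2 hst)
      have a2 := abs_lt.1 ((hU v hv).2 (hst.trans hsv))
      exact abs_le.2 ⟨by linarith, by linarith⟩
  choose U hUo htU hU using hloc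
  obtain ⟨δ, hδ, hball⟩ := lebesgue_number_lemma_of_metric (s := Set.univ) (c := U)
    isCompact_univ hUo (fun t _ => Set.mem_iUnion.2 ⟨t, htU t⟩)
  refine ⟨δ, hδ, fun a b hab r s t har hrs hst htb => ?_⟩
  obtain ⟨i, hi⟩ := hball a (Set.mem_univ _)
  have hin : ∀ u, a ≤ u → u ≤ b → u ∈ U i := by
    intro u hau hub
    refine hi ?_
    have hau' : (a : ℝ) ≤ u := hau
    have hub' : (u : ℝ) ≤ b := hub
    rw [Metric.mem_ball, Subtype.dist_eq, Real.dist_eq, abs_of_nonneg (by linarith)]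
    linarith
  exact hU i r (hin r har (hrs.trans (hst.trans htb))) s (hin s (har.trans hrs) (hst.trans htb))
    t (hin t (har.trans (hrs.trans hst)) htb) hrs hst

/-- Discretizations along partitions with mesh tending to zero converge. -/
theorem tendsto_discretize (x : Cadlag) {k : ℕ → ℕ} (σ : ∀ m, TimeGrid (k m + 1)) {δ : ℕ → ℝ}
    (hσ : ∀ m, (σ m).MeshLE (δ m)) (hδ : Tendsto δ atTop (𝓝 0)) :
    Tendsto (fun m => (σ m).discretize x) atTop (𝓝 x) := by
  rw [Metric.tendsto_atTop']
  intro e he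
  have he4 : 0 < e / 4 := by positivity
  obtain ⟨η, hη, hosc⟩ := x.exists_smallTripleOsc he4
  obtain ⟨l, hl⟩ := x.left_limit 1
  have h1 : ∀ᶠ s in 𝓝[<] (1 : unitInterval), |x s - l| < e / 4 := by
    simpa [Real.dist_eq] using hl.eventually (Metric.ball_mem_nhds _ he4)
  -- Once the mesh is below `1 - v`, the last grid interval lies in `(v, 1]`, where `x` is close to
  -- its left limit at `1` except perhaps at `1`.
  obtain ⟨v, hv1, hv⟩ := (mem_nhdsLT_iff_exists_Ioo_subset' (zero_lt_one' unitInterval)).1 h1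
  have hv1' : (0 : ℝ) < 1 - v := sub_pos.2 hv1
  have hev : ∀ᶠ m in atTop, δ m < min (e / 4) (min η (1 - v)) :=
    hδ.eventually (gt_mem_nhds (lt_min he4 (lt_min hη hv1')))
  obtain ⟨N, hN⟩ := eventually_atTop.1 hev
  refine ⟨N, fun m hm => ?_⟩
  have hm' := hN m hm.le
  have b1 : δ m < e / 4 := hm'.trans_le (min_le_left _ _)
  have b2 : δ m < η := hm'.trans_le ((min_le_right _ _).trans (min_le_left _ _))
  have b3 : δ m < 1 - v := hm'.trans_le ((min_le_right _ _).trans (min_le_right _ _))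
  refine (dist_discretize_le (σ m) x he4 (hσ m)
    (fun i hi => hosc _ _ ((hσ m i hi).trans_lt b2)) fun u hu hu1 => ?_).trans_lt
    (max_lt (by linarith) (by linarith))
  have hlast := hσ m (k m) (Nat.lt_succ_self _)
  rw [(σ m).last] at hlast
  have hvk : v < (σ m).pts (k m) := by
    change (v : ℝ) < _
    rw [Set.Icc.coe_one] at hlast
    linarith
  have a1 : |x u - l| < e / 4 := hv ⟨hvk.trans_le hu, hu1⟩
  have a2 : |x ((σ m).pts (k m)) - l| < e / 4 := hv ⟨hvk, hu.trans_lt hu1⟩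
  rw [abs_lt] at a1 a2
  exact abs_le.2 ⟨by linarith, by linarith⟩

end Cadlag

/-! ### Projections: continuity, measurability and the size of `contTimes` -/

namespace Cadlag

/-- The time change of a nearby path moves `t` only slightly, and `x` varies little there. -/
theorem continuousAt_eval {x : Cadlag} {t : unitInterval} (h : ContinuousAt x t) :
    ContinuousAt (fun y : Cadlag => y t) x := by
  rw [Metric.continuousAt_iff] at h ⊢
  intro e he
  obtain ⟨d, hd, hx⟩ := h (e / 2) (half_pos he)
  refine ⟨min (d / 2) (e / 2), lt_min (half_pos hd) (half_pos he), fun y hy => ?_⟩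
  obtain ⟨lam, h1, h2⟩ := exists_of_dist_lt (show skorokhodDist y x < _ from hy)
  have a1 : dist (lam t) t < d :=
    ((h1 t).trans (min_le_left _ _)).trans_lt (half_lt_self hd)
  have a2 := hx a1
  have a3 := (h2 t).trans (min_le_right _ _)
  have a4 := dist_triangle (y t) (x (lam t)) (x t)
  rw [Real.dist_eq (y t) (x (lam t))] at a4
  linarith

theorem continuous_eval_of_fixed {t : unitInterval}
    (ht : ∀ lam : unitInterval ≃o unitInterval, lam t = t) :
    Continuous fun y : Cadlag => y t := by
  refine (LipschitzWith.mk_one fun x y => ?_).continuous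
  refine le_of_forall_gt_imp_ge_of_dense fun c hc => ?_
  obtain ⟨lam, -, h2⟩ := exists_of_dist_lt (show skorokhodDist x y < c from hc)
  simpa only [ht, Real.dist_eq] using h2 t

theorem zero_mem_contTimes (P : Measure Cadlag) : 0 ∈ contTimes P :=
  Set.mem_ofPred.2 <| Eventually.of_forall fun _ =>
    (continuous_eval_of_fixed fun lam => lam.map_bot).continuousAt

theorem one_mem_contTimes (P : Measure Cadlag) : 1 ∈ contTimes P :=
  Set.mem_ofPred.2 <| Eventually.of_forall fun _ =>
    (continuous_eval_of_fixed fun lam => lam.map_top).continuousAt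

/-- A small time change keeps the witness `s` inside the open interval. Such sets replace the
evaluations, which need not be continuous, in the proof of `measurable_eval`. -/
theorem isOpen_setOf_exists_lt (a b : unitInterval) (c : ℝ) :
    IsOpen {x : Cadlag | ∃ s ∈ Set.Ioo a b, c < x s} := by
  rw [Metric.isOpen_iff]
  rintro x ⟨s, ⟨has, hsb⟩, hs⟩
  have has' : (a : ℝ) < s := has
  have hsb' : (s : ℝ) < b := hsb
  set e : ℝ := min ((x s - c) / 2) (min (((s : ℝ) - a) / 2) (((b : ℝ) - s) / 2)) with he
  have hepos : 0 < e := lt_min (by linarith) (lt_min (by linarith) (by linarith))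
  refine ⟨e, hepos, fun y hy => ?_⟩
  rw [Metric.mem_ball, dist_comm] at hy
  obtain ⟨lam, h1, h2⟩ := exists_of_dist_lt (show skorokhodDist x y < e from hy)
  have e1 : e ≤ (x s - c) / 2 := min_le_left _ _
  have e2 : e ≤ ((s : ℝ) - a) / 2 := (min_le_right _ _).trans (min_le_left _ _)
  have e3 : e ≤ ((b : ℝ) - s) / 2 := (min_le_right _ _).trans (min_le_right _ _)
  have b1 := abs_le.1 (h1 s)
  have b2 := abs_le.1 (h2 s)
  refine ⟨lam s, ⟨?_, ?_⟩, by linarith⟩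
  · change (a : ℝ) < lam s
    linarith
  · change (lam s : ℝ) < b
    linarith

theorem measurable_eval (t : unitInterval) : Measurable fun x : Cadlag => x t := by
  rcases eq_or_lt_of_le (show t ≤ 1 from t.2.2) with rfl | ht
  · exact (continuous_eval_of_fixed fun lam => lam.map_top).measurable
  obtain ⟨u, -, hu, hlim⟩ := exists_seq_strictAnti_tendsto' ht
  refine measurable_of_Iio fun c => ?_
  -- By right continuity, `x t < c` means that `x` stays below some rational `q < c` on a short
  -- interval to the right of `t`.
  have heq : (fun x : Cadlag => x t) ⁻¹' Set.Iio c =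
      ⋃ q : ℚ, ⋃ _ : (q : ℝ) < c, ⋃ n : ℕ, {x : Cadlag | ∃ s ∈ Set.Ioo t (u n), (q : ℝ) < x s}ᶜ := by
    ext x
    simp only [Set.mem_preimage, Set.mem_Iio, Set.mem_iUnion, Set.mem_compl_iff, Set.mem_ofPred_eq,
      not_exists, not_and, not_lt, exists_prop]
    constructor
    · intro hx
      obtain ⟨q, hq1, hq2⟩ := exists_rat_btwn hx
      refine ⟨q, hq2, ?_⟩
      have hev : ∀ᶠ s in 𝓝[≥] t, x s < q := (x.right_continuous t).eventually (gt_mem_nhds hq1)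
      obtain ⟨v, hv, hvs⟩ := (mem_nhdsGE_iff_exists_Ico_subset' ht).1 hev
      obtain ⟨n, hn⟩ := (hlim.eventually (gt_mem_nhds hv)).exists
      exact ⟨n, fun s hs => le_of_lt (hvs ⟨hs.1.le, hs.2.trans hn⟩)⟩
    · rintro ⟨q, hqc, n, hn⟩
      refine lt_of_le_of_lt ?_ hqc
      have : (𝓝[>] t).NeBot := nhdsGT_neBot_of_exists_gt ⟨1, ht⟩
      refine le_of_tendsto ((x.right_continuous t).mono_left
        (nhdsWithin_mono _ Set.Ioi_subset_Ici_self)) ?_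
      filter_upwards [Ioo_mem_nhdsGT (hu n).1] with s hs
      exact hn s hs
  rw [heq]
  exact MeasurableSet.iUnion fun q => MeasurableSet.iUnion fun _ => MeasurableSet.iUnion fun n =>
    (isOpen_setOf_exists_lt t (u n) q).measurableSet.compl

/-- The size of the jump of `x` at `t`, truncated at `1`. -/
noncomputable def jump (t : unitInterval) (x : Cadlag) : ℝ :=
  min 1 |x t - Function.leftLim x.toFun t|

theorem tendsto_leftLim (x : Cadlag) (t : unitInterval) :
    Tendsto x (𝓝[<] t) (𝓝 (Function.leftLim x.toFun t)) :=
  tendsto_leftLim_of_tendsto (x.left_limit t)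

theorem measurable_jump (t : unitInterval) : Measurable (jump t) := by
  refine measurable_const.min (Measurable.abs ?_)
  rcases eq_or_neBot (𝓝[<] t) with h | h
  · have : (fun x : Cadlag => x t - Function.leftLim x.toFun t) = fun _ => 0 := by
      funext x
      rw [leftLim_eq_of_eq_bot _ h, sub_self]
    rw [this]
    exact measurable_const
  · exact (measurable_eval t).sub (measurable_of_tendsto_metrizable' (𝓝[<] t) measurable_eval
      (tendsto_pi_nhds.2 fun x => x.tendsto_leftLim t))

/-- Just to the left of `t`, both the values of `x` and its left limits are close to the left limit
at `t`. -/
theorem tendsto_jump (x : Cadlag) (t : unitInterval) :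
    Tendsto (fun s => jump s x) (𝓝[<] t) (𝓝 0) := by
  rcases eq_or_ne t 0 with rfl | h0
  · have : 𝓝[<] (0 : unitInterval) = ⊥ := by
      rw [show Set.Iio (0 : unitInterval) = ∅ from Set.Iio_bot]; exact nhdsWithin_empty _
    rw [this]; exact tendsto_bot
  have ht : 0 < t := unitInterval.pos_iff_ne_zero.2 h0
  set l := Function.leftLim x.toFun t
  rw [Metric.tendsto_nhds]
  intro e he
  have h1 : ∀ᶠ s in 𝓝[<] t, |x s - l| < e / 3 := by
    simpa [Real.dist_eq] using
      (x.tendsto_leftLim t).eventually (Metric.ball_mem_nhds _ (by positivity : 0 < e / 3))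
  obtain ⟨u, hu, hus⟩ := (mem_nhdsLT_iff_exists_Ioo_subset' ht).1 h1
  filter_upwards [Ioo_mem_nhdsLT hu] with s hs
  have : (𝓝[<] s).NeBot := nhdsLT_neBot_of_exists_lt ⟨u, hs.1⟩
  have a1 : |x s - l| < e / 3 := hus hs
  have a2 : |Function.leftLim x.toFun s - l| ≤ e / 3 := by
    refine le_of_tendsto ((x.tendsto_leftLim s).sub_const l).abs ?_
    filter_upwards [Ioo_mem_nhdsLT hs.1] with v hv
    exact le_of_lt (hus ⟨hv.1, hv.2.trans hs.2⟩)
  have a3 : jump s x ≤ |x s - Function.leftLim x.toFun s| := min_le_right _ _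
  have a4 := abs_sub_le (x s) l (Function.leftLim x.toFun s)
  rw [abs_sub_comm l] at a4
  have a5 : 0 ≤ jump s x := le_min zero_le_one (abs_nonneg _)
  rw [Real.dist_eq, sub_zero, abs_of_nonneg a5]
  linarith

theorem continuousAt_of_jump_eq_zero {x : Cadlag} {t : unitInterval} (h : jump t x = 0) :
    ContinuousAt x t := by
  have h1 : Function.leftLim x.toFun t = x t := by
    rcases min_choice 1 |x t - Function.leftLim x.toFun t| with h' | h'
    · rw [jump, h'] at h; exact absurd h one_ne_zero
    · rw [jump, h', abs_eq_zero, sub_eq_zero] at h; exact h.symm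
  have h2 := x.tendsto_leftLim t
  rw [h1] at h2
  rw [ContinuousAt, ← nhdsLT_sup_nhdsGE]
  exact h2.sup (x.right_continuous t)

/-- The mean truncated jump `j` vanishes only if almost every path is continuous at `t`. By
dominated convergence `j` has left limit zero everywhere, so the points of each set where `j`
exceeds a positive level are isolated from the left; there are countably many of these. -/
theorem countable_compl_contTimes (P : Measure Cadlag) [IsFiniteMeasure P] :
    (contTimes P)ᶜ.Countable := by
  set j : unitInterval → ENNReal := fun t => ∫⁻ x, ENNReal.ofReal (jump t x) ∂P with hj
  have hlim : ∀ t, Tendsto j (𝓝[<] t) (𝓝 0) := by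
    intro t
    have := tendsto_lintegral_filter_of_dominated_convergence (μ := P) (l := 𝓝[<] t)
      (F := fun s x => ENNReal.ofReal (jump s x)) (f := fun _ => 0) (fun _ => 1)
      (Eventually.of_forall fun s => (measurable_jump s).ennreal_ofReal)
      (Eventually.of_forall fun s => Eventually.of_forall fun x => by
        rw [← ENNReal.ofReal_one]; exact ENNReal.ofReal_le_ofReal (min_le_left _ _))
      (by simp) (Eventually.of_forall fun x => by
        simpa using ENNReal.tendsto_ofReal (x.tendsto_jump t))
    simpa using this
  have hsub : (contTimes P)ᶜ ⊆ ⋃ n : ℕ, {t | ((n : ENNReal) + 1)⁻¹ ≤ j t} := by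
    intro t ht
    by_contra hcon
    simp only [Set.mem_iUnion, Set.mem_ofPred_eq, not_exists, not_le] at hcon
    have hj0 : j t = 0 := by
      by_contra h0
      obtain ⟨n, hn⟩ := ENNReal.exists_inv_nat_lt h0
      have := hcon n
      exact absurd (this.trans_le' (hn.le.trans' (ENNReal.inv_le_inv.2 le_self_add)))
        (lt_irrefl _)
    refine ht ?_
    have := (lintegral_eq_zero_iff (measurable_jump t).ennreal_ofReal).1 hj0
    filter_upwards [this] with x hx
    refine continuousAt_eval (continuousAt_of_jump_eq_zero (le_antisymm ?_ ?_))
    · exact ENNReal.ofReal_eq_zero.1 hx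
    · exact le_min zero_le_one (abs_nonneg _)
  refine (Set.countable_iUnion fun n => ?_).mono hsub
  refine (countable_setOfPred_isolated_left_within
    (s := {t | ((n : ENNReal) + 1)⁻¹ ≤ j t})).mono ?_
  intro t ht
  refine ⟨ht, ?_⟩
  have h1 : ∀ᶠ s in 𝓝[<] t, j s < ((n : ENNReal) + 1)⁻¹ :=
    (hlim t).eventually (gt_mem_nhds (ENNReal.inv_pos.2 (by finiteness)))
  rw [← empty_mem_iff_bot]
  filter_upwards [nhdsWithin_mono t Set.inter_subset_right h1, self_mem_nhdsWithin] with s hs hs'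
  exact absurd hs (not_lt.2 hs'.1)

theorem exists_mem_contTimes (P : Measure Cadlag) [IsFiniteMeasure P] {a b : unitInterval}
    (hab : a < b) : ∃ t ∈ contTimes P, a < t ∧ t < b := by
  by_contra! hcon
  have h1 : (Set.Ioo a b).Countable := by
    refine (countable_compl_contTimes P).mono ?_
    intro t ht hmem
    exact absurd ht.2 (not_lt.2 (hcon t hmem ht.1))
  have h2 : (Set.Ioo (a : ℝ) b).Countable := by
    refine (h1.image Subtype.val).mono fun v hv => ?_
    exact ⟨⟨v, a.2.1.trans hv.1.le, hv.2.le.trans b.2.2⟩, hv, rfl⟩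
  exact absurd (Cardinal.Real.Ioo_countable_iff.1 h2) (not_le.2 hab)

end Cadlag

theorem TimeGrid.exists_meshLE {T : Set unitInterval} (h0 : 0 ∈ T) (h1 : 1 ∈ T)
    (hT : ∀ a b : unitInterval, a < b → ∃ t ∈ T, a < t ∧ t < b) (k : ℕ) :
    ∃ σ : TimeGrid (k + 1), (∀ i, σ.pts i ∈ T) ∧ σ.MeshLE (2 / (k + 1)) := by
  have hk : (0 : ℝ) < k + 1 := by positivity
  have hex : ∀ i : ℕ, ∃ t ∈ T, 0 < i → i < k + 1 →
      (i : ℝ) / (k + 1) < t ∧ (t : ℝ) < (i + 1) / (k + 1) := by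
    intro i
    by_cases hi : i < k + 1
    · have hi' : (i : ℝ) + 1 ≤ k + 1 := by exact_mod_cast hi
      have hlt : (i : ℝ) / (k + 1) < (i + 1) / (k + 1) := by gcongr; linarith
      obtain ⟨t, ht, h⟩ := hT
        ⟨(i : ℝ) / (k + 1), by positivity, (div_le_one hk).2 (by linarith)⟩
        ⟨((i : ℝ) + 1) / (k + 1), by positivity, (div_le_one hk).2 hi'⟩ hlt
      exact ⟨t, ht, fun _ _ => h⟩
    · exact ⟨0, h0, fun _ h => absurd h hi⟩
  choose p hpT hp using hex
  -- The interior point `i` lies in the `i`-th cell of length `1 / (k + 1)`, so neighbours differ by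
  -- at most two cells.
  let q : ℕ → unitInterval := fun i => if i = 0 then 0 else if i < k + 1 then p i else 1
  have hq0 : q 0 = 0 := if_pos rfl
  have hq1 : ∀ i, k + 1 ≤ i → q i = 1 := fun i hi => by
    simp only [q, if_neg (show ¬ i = 0 by omega), if_neg (not_lt.2 hi)]
  have hlow : ∀ i, 0 < i → i ≤ k + 1 → (i : ℝ) / (k + 1) ≤ q i := by
    intro i hi hik
    rcases hik.lt_or_eq with h | rfl
    · simp only [q, if_neg (show ¬ i = 0 by omega), if_pos h]
      exact (hp i hi h).1.le
    · rw [hq1 _ le_rfl]; push_cast; rw [div_self hk.ne']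
  have hup : ∀ i, 0 < i → i < k + 1 → (q i : ℝ) < (i + 1) / (k + 1) := by
    intro i hi h
    simp only [q, if_neg (show ¬ i = 0 by omega), if_pos h]
    exact (hp i hi h).2
  have hlow0 : ∀ i, i ≤ k + 1 → (i : ℝ) / (k + 1) ≤ q i := by
    intro i hik
    rcases Nat.eq_zero_or_pos i with rfl | hi
    · simp [hq0]
    · exact hlow i hi hik
  have hup0 : ∀ i, i < k + 1 → (q i : ℝ) < (i + 1) / (k + 1) := by
    intro i hik
    rcases Nat.eq_zero_or_pos i with rfl | hi
    · rw [hq0]; simp; positivity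
    · exact hup i hi hik
  refine ⟨⟨q, hq0, hq1 _ le_rfl, fun i hi => ?_⟩, fun i => ?_, fun i hi => ?_⟩
  · change (q i : ℝ) < q (i + 1)
    have a1 := hup0 i hi
    have a2 := hlow0 (i + 1) hi
    push_cast at a2
    linarith
  · change q i ∈ T
    simp only [q]
    split_ifs
    exacts [h0, hpT i, h1]
  · change (q (i + 1) : ℝ) - q i ≤ _
    have a1 := hlow0 i hi.le
    have a2 : (q (i + 1) : ℝ) ≤ (i + 2) / (k + 1) := by
      rcases (show i + 1 ≤ k + 1 from hi).lt_or_eq with h | h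
      · have := (hup0 (i + 1) h).le
        push_cast at this
        linarith [show ((i : ℝ) + 1 + 1) / (k + 1) = (i + 2) / (k + 1) by ring]
      · rw [h, hq1 _ le_rfl]
        have : (i : ℝ) + 1 = k + 1 := by exact_mod_cast h
        rw [le_div_iff₀ hk]
        simp
        linarith
    have a3 : ((i : ℝ) + 2) / (k + 1) - i / (k + 1) = 2 / (k + 1) := by ring
    linarith

/-! ### Dyadic chaining and the maximal inequality -/

/-- Chaining along dyadic levels: if at every level one of any two adjacent increments is small,
then one of any two consecutive increments is bounded by twice the sum of the bounds. -/
theorem dyadic_tripleOsc_le {v : ℕ → ℕ → ℝ} (hv : ∀ m i, v (m + 1) (2 * i) = v m i)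
    {e : ℕ → ℝ} (he : ∀ m, 0 ≤ e m)
    (h : ∀ m i, i + 2 ≤ 2 ^ (m + 1) → |v (m + 1) (i + 1) - v (m + 1) i| ≤ e m ∨
      |v (m + 1) (i + 2) - v (m + 1) (i + 1)| ≤ e m) (m : ℕ) :
    ∀ i j l, i ≤ j → j ≤ l → l ≤ 2 ^ m →
      |v m j - v m i| ≤ 2 * ∑ p ∈ Finset.range m, e p ∨
      |v m l - v m j| ≤ 2 * ∑ p ∈ Finset.range m, e p := by
  induction m with
  | zero =>
    intro i j l hij hjl hl
    rw [pow_zero] at hl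
    rcases Nat.eq_zero_or_pos j with rfl | hj
    · obtain rfl : i = 0 := by omega
      left; simp
    · obtain rfl : l = j := by omega
      right; simp
  | succ m ih =>
    -- Each odd point is rounded to the even neighbour across its small increment. Rounding is
    -- monotone and moves each value by at most `e m`, hence each increment by at most `2 * e m`.
    have hex : ∀ i, ∃ i', i ≤ 2 ^ (m + 1) → (i ≤ 2 * i' + 1 ∧ 2 * i' ≤ i + 1 ∧
        (i % 2 = 0 → 2 * i' = i)) ∧ |v (m + 1) i - v m i'| ≤ e m := by
      intro i
      rcases Nat.even_or_odd' i with ⟨c, rfl | rfl⟩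
      · refine ⟨c, fun _ => ⟨by omega, ?_⟩⟩
        rw [hv]; simpa using he m
      · by_cases hc : 2 * c + 1 ≤ 2 ^ (m + 1)
        · have hc' : 2 * c + 2 ≤ 2 ^ (m + 1) := by rw [pow_succ'] at hc ⊢; omega
          rcases h m (2 * c) hc' with h1 | h1
          · exact ⟨c, fun _ => ⟨by omega, by rwa [hv] at h1⟩⟩
          · refine ⟨c + 1, fun _ => ⟨by omega, ?_⟩⟩
            rwa [show 2 * c + 2 = 2 * (c + 1) by ring, hv, abs_sub_comm] at h1
        · exact ⟨0, fun h => absurd h hc⟩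
    choose n hn using hex
    have hmono : ∀ i j, i ≤ j → j ≤ 2 ^ (m + 1) → n i ≤ n j := by
      intro i j hij hj
      rcases hij.eq_or_lt with rfl | hlt
      · exact le_rfl
      · have h1 := (hn i (by omega)).1
        have h2 := (hn j hj).1
        omega
    intro i j l hij hjl hl
    have hl' : n l ≤ 2 ^ m := by
      have := (hn l hl).1
      rw [pow_succ'] at hl
      omega
    have b1 := abs_le.1 (hn i (by omega)).2
    have b2 := abs_le.1 (hn j (by omega)).2
    have b3 := abs_le.1 (hn l hl).2
    rw [Finset.sum_range_succ, mul_add]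
    rcases ih (n i) (n j) (n l) (hmono i j hij (by omega)) (hmono j l hjl hl) hl' with h1 | h1
    · left
      have := abs_le.1 h1
      exact abs_le.2 ⟨by linarith, by linarith⟩
    · right
      have := abs_le.1 h1
      exact abs_le.2 ⟨by linarith, by linarith⟩

/-- In this time scale dyadic intervals of one level have equal `H`-length, so the moment bound is
the same for all of them. -/
theorem exists_timeScale {H : unitInterval → ℝ} (hH : StrictMono H) (hc : Continuous H)
    {a b : unitInterval} (hab : a < b) :
    ∃ q : ℝ → unitInterval, ∀ u ∈ Set.Icc (0 : ℝ) 1, H (q u) = H a + u * (H b - H a) := by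
  have hex : ∀ u : ℝ, ∃ t, u ∈ Set.Icc (0 : ℝ) 1 → H t = H a + u * (H b - H a) := by
    intro u
    by_cases hu : u ∈ Set.Icc (0 : ℝ) 1
    · have hpos : 0 < H b - H a := sub_pos.2 (hH hab)
      obtain ⟨t, -, ht⟩ := intermediate_value_Icc hab.le hc.continuousOn
        (show H a + u * (H b - H a) ∈ Set.Icc (H a) (H b) from
          ⟨by nlinarith [hu.1], by nlinarith [hu.2]⟩)
      exact ⟨t, fun _ => ht⟩
    · exact ⟨a, fun h => absurd h hu⟩
  choose q hq using hex
  exact ⟨q, hq⟩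

namespace Cadlag

/-- To bound the triple oscillation of a càdlàg function it suffices to look at adjacent dyadic
points, in the time scale given by a strictly increasing continuous function. -/
theorem smallTripleOsc_of_dyadic (x : Cadlag) {H : unitInterval → ℝ} (hH : StrictMono H)
    (hc : Continuous H) {a b : unitInterval} (hab : a < b) {q : ℝ → unitInterval}
    (hq : ∀ u ∈ Set.Icc (0 : ℝ) 1, H (q u) = H a + u * (H b - H a))
    {e : ℕ → ℝ} (he : ∀ m, 0 ≤ e m) {ε : ℝ} (hsum : ∀ m, 2 * ∑ p ∈ Finset.range m, e p ≤ ε)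
    (h : ∀ m i : ℕ, i + 2 ≤ 2 ^ (m + 1) →
      |x (q ((i + 1 : ℕ) / 2 ^ (m + 1))) - x (q (i / 2 ^ (m + 1)))| ≤ e m ∨
      |x (q ((i + 2 : ℕ) / 2 ^ (m + 1))) - x (q ((i + 1 : ℕ) / 2 ^ (m + 1)))| ≤ e m) :
    SmallTripleOsc x a b ε := by
  have hdy := dyadic_tripleOsc_le (v := fun m i => x (q (i / 2 ^ m))) (fun m i => by
    congr 2; push_cast; rw [pow_succ']; field_simp) he h
  have hpos : 0 < H b - H a := sub_pos.2 (hH hab)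
  have hemb : IsEmbedding H := (hc.isClosedEmbedding hH.injective).isEmbedding
  have hN : ∀ (u : ℝ) (m : ℕ), u ≤ 1 → ⌈u * 2 ^ m⌉₊ ≤ 2 ^ m := by
    intro u m hu
    refine Nat.ceil_le.2 ?_
    push_cast
    exact mul_le_of_le_one_left (by positivity) hu
  -- Rounding up gives dyadic times approaching `r` from the right, as right continuity requires;
  -- order is preserved as well.
  have hlim : ∀ r, a ≤ r → r ≤ b → Tendsto
      (fun m : ℕ => x (q (⌈(H r - H a) / (H b - H a) * 2 ^ m⌉₊ / 2 ^ m))) atTop (𝓝 (x r)) := by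
    intro r har hrb
    set u := (H r - H a) / (H b - H a) with hu
    have hu0 : 0 ≤ u := div_nonneg (sub_nonneg.2 (hH.monotone har)) hpos.le
    have hu1 : u ≤ 1 := (div_le_one hpos).2 (sub_le_sub_right (hH.monotone hrb) _)
    have hur : H r = H a + u * (H b - H a) := by rw [hu, div_mul_cancel₀ _ hpos.ne']; ring
    have hin : ∀ m : ℕ, (⌈u * 2 ^ m⌉₊ : ℝ) / 2 ^ m ∈ Set.Icc (0 : ℝ) 1 := fun m =>
      ⟨by positivity, (div_le_one (by positivity)).2 (by exact_mod_cast hN u m hu1)⟩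
    refine (x.right_continuous r).tendsto.comp (tendsto_nhdsWithin_iff.2 ⟨?_, ?_⟩)
    · rw [hemb.tendsto_nhds_iff, hur]
      have h1 : Tendsto (fun m : ℕ => (⌈u * 2 ^ m⌉₊ : ℝ) / 2 ^ m) atTop (𝓝 u) :=
        (tendsto_nat_ceil_mul_div_atTop hu0).comp
          (tendsto_pow_atTop_atTop_of_one_lt (one_lt_two : (1 : ℝ) < 2))
      refine ((h1.mul_const (H b - H a)).const_add (H a)).congr fun m => ?_
      exact (hq _ (hin m)).symm
    · refine Eventually.of_forall fun m => ?_
      refine hH.le_iff_le.1 ?_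
      rw [hq _ (hin m), hur]
      have : u ≤ (⌈u * 2 ^ m⌉₊ : ℝ) / 2 ^ m := (le_div_iff₀ (by positivity)).2 (Nat.le_ceil _)
      gcongr
  intro r s t har hrs hst htb
  -- As a bound on a minimum, the alternative is closed and passes to the limit.
  rw [← min_le_iff]
  refine le_of_tendsto'
    (((hlim s (har.trans hrs) (hst.trans htb)).sub
        (hlim r har (hrs.trans (hst.trans htb)))).abs.min
      ((hlim t (har.trans (hrs.trans hst)) htb).sub
        (hlim s (har.trans hrs) (hst.trans htb))).abs) fun m => ?_
  have hceil : ∀ {r s : unitInterval}, r ≤ s →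
      ⌈(H r - H a) / (H b - H a) * 2 ^ m⌉₊ ≤ ⌈(H s - H a) / (H b - H a) * 2 ^ m⌉₊ := by
    intro r s hrs
    have := hH.monotone hrs
    gcongr
  refine min_le_iff.2 ((hdy m _ _ _ (hceil hrs) (hceil hst) (hN _ m ?_)).imp
    (fun h => h.trans (hsum m)) fun h => h.trans (hsum m))
  exact (div_le_one hpos).2 (sub_le_sub_right (hH.monotone htb) _)

end Cadlag

/-- The constant of the chaining bound with allowance `e m` at level `m`. -/
noncomputable def chainConst (α β : ℝ) (e : ℕ → ℝ) : ENNReal :=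
  ∑' m, ENNReal.ofReal (2 ^ (m + 1) * ((1 / 2 ^ m) ^ α / (e m ^ β * e m ^ β)))

theorem exists_chainConst_ne_top {α β ε : ℝ} (hα : 1 < α) (hβ : 0 < β) (hε : 0 < ε) :
    ∃ e : ℕ → ℝ, (∀ m, 0 < e m) ∧ (∀ m, 2 * ∑ p ∈ Finset.range m, e p ≤ ε) ∧
      chainConst α β e ≠ ⊤ := by
  -- With `e m = c * θ ^ m` the level-`m` term is proportional to `2 ^ (-m * (α - 1))` divided by `θ
  -- ^ (2 * β * m)`. This `θ` spends half of the exponent, leaving the geometric ratio `ρ = 2 ^ (-(α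
  -- - 1) / 2)`; `c` normalizes the sum of the allowances to `ε / 2`.
  set θ : ℝ := 2 ^ (-(α - 1) / (4 * β)) with hθ
  have hθ0 : 0 < θ := Real.rpow_pos_of_pos two_pos _
  have hθ1 : θ < 1 := Real.rpow_lt_one_of_one_lt_of_neg one_lt_two
    (div_neg_of_neg_of_pos (by linarith) (by linarith))
  set c : ℝ := ε * (1 - θ) / 2 with hc
  have hc0 : 0 < c := by have := sub_pos.2 hθ1; positivity
  refine ⟨fun m => c * θ ^ m, fun m => by positivity, fun m => ?_, ?_⟩
  · rw [← Finset.mul_sum]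
    have h1 : (∑ p ∈ Finset.range m, θ ^ p) * (1 - θ) = 1 - θ ^ m := geom_sum_mul_neg θ m
    have h2 : 0 < θ ^ m := by positivity
    calc 2 * (c * ∑ p ∈ Finset.range m, θ ^ p)
        = ε * ((∑ p ∈ Finset.range m, θ ^ p) * (1 - θ)) := by rw [hc]; ring
      _ ≤ ε * 1 := by rw [h1]; gcongr; linarith
      _ = ε := mul_one ε
  · set ρ : ℝ := 2 ^ (-(α - 1) / 2) with hρ
    have hρ0 : 0 < ρ := Real.rpow_pos_of_pos two_pos _
    have hρ1 : ρ < 1 := Real.rpow_lt_one_of_one_lt_of_neg one_lt_two (by linarith)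
    have hθβ : θ ^ β * θ ^ β = ρ := by
      rw [hθ, hρ, ← Real.rpow_mul zero_le_two, ← Real.rpow_add two_pos]
      congr 1; field_simp; ring
    have h2α : (2 : ℝ) * (1 / 2) ^ α = ρ * ρ := by
      rw [hρ, one_div, Real.inv_rpow zero_le_two, ← Real.rpow_neg zero_le_two,
        ← Real.rpow_add two_pos]
      nth_rewrite 1 [← Real.rpow_one 2]
      rw [← Real.rpow_add two_pos]
      congr 1; ring
    have hterm : ∀ m : ℕ, 2 ^ (m + 1) * (((1 : ℝ) / 2 ^ m) ^ α /
        ((c * θ ^ m) ^ β * (c * θ ^ m) ^ β)) = 2 / (c ^ β * c ^ β) * ρ ^ m := by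
      intro m
      have e1 : ((1 : ℝ) / 2 ^ m) ^ α = ((1 / 2) ^ α) ^ m := by
        rw [← one_div_pow, ← Real.rpow_natCast, ← Real.rpow_mul (by norm_num), mul_comm,
          Real.rpow_mul (by norm_num), Real.rpow_natCast]
      have e2 : (c * θ ^ m) ^ β = c ^ β * (θ ^ β) ^ m := by
        rw [Real.mul_rpow hc0.le (by positivity), ← Real.rpow_natCast, ← Real.rpow_mul hθ0.le,
          mul_comm (m : ℝ), Real.rpow_mul hθ0.le, Real.rpow_natCast]
      have hcβ : 0 < c ^ β := Real.rpow_pos_of_pos hc0 β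
      rw [e1, e2, show c ^ β * (θ ^ β) ^ m * (c ^ β * (θ ^ β) ^ m)
        = c ^ β * c ^ β * (θ ^ β * θ ^ β) ^ m by rw [mul_pow]; ring, hθβ]
      rw [show (2 : ℝ) ^ (m + 1) * (((1 / 2) ^ α) ^ m / (c ^ β * c ^ β * ρ ^ m))
        = 2 * (2 * (1 / 2) ^ α) ^ m / (c ^ β * c ^ β * ρ ^ m) by rw [mul_pow, pow_succ]; ring, h2α,
        mul_pow]
      field_simp
    have hs : Summable fun m : ℕ => 2 / (c ^ β * c ^ β) * ρ ^ m :=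
      (summable_geometric_of_lt_one hρ0.le hρ1).mul_left _
    rw [chainConst]
    simp only [hterm]
    exact hs.tsum_ofReal_ne_top

/-- A maximal inequality for the triple oscillation. -/
theorem measure_not_smallTripleOsc_le {Ω : Type*} [MeasurableSpace Ω] (μ : Measure Ω)
    {X : Ω → Cadlag} (hX : Measurable X) {α β : ℝ} (hβ : 0 < β) {H : unitInterval → ℝ}
    (hH : StrictMono H) (hc : Continuous H)
    (hmom : ∀ r s t : unitInterval, r ≤ s → s ≤ t →
      ∫⁻ ω, ENNReal.ofReal (|X ω s - X ω r| ^ β * |X ω t - X ω s| ^ β) ∂μ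
        ≤ ENNReal.ofReal ((H t - H r) ^ α))
    {e : ℕ → ℝ} (he : ∀ m, 0 < e m) {ε : ℝ} (hsum : ∀ m, 2 * ∑ p ∈ Finset.range m, e p ≤ ε)
    {a b : unitInterval} (hab : a < b) :
    μ {ω | ¬ SmallTripleOsc (X ω) a b ε} ≤
      chainConst α β e * ENNReal.ofReal ((H b - H a) ^ α) := by
  obtain ⟨q, hq⟩ := exists_timeScale hH hc hab
  have hpos : 0 < H b - H a := sub_pos.2 (hH hab)
  have hXm : ∀ t, Measurable fun ω => X ω t := fun t => (Cadlag.measurable_eval t).comp hX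
  set B : ℕ → ℕ → Set Ω := fun m i => {ω |
    e m < |X ω (q ((i + 1 : ℕ) / 2 ^ (m + 1))) - X ω (q (i / 2 ^ (m + 1)))| ∧
    e m < |X ω (q ((i + 2 : ℕ) / 2 ^ (m + 1))) - X ω (q ((i + 1 : ℕ) / 2 ^ (m + 1)))|} with hB
  set I : ℕ → Finset ℕ := fun m => (Finset.range (2 ^ (m + 1))).filter
    fun i => i + 2 ≤ 2 ^ (m + 1) with hI
  have hsub : {ω | ¬ SmallTripleOsc (X ω) a b ε} ⊆ ⋃ m, ⋃ i ∈ I m, B m i := by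
    intro ω hω
    by_contra hcon
    refine hω ((X ω).smallTripleOsc_of_dyadic hH hc hab hq (fun m => (he m).le) hsum ?_)
    intro m i hi
    by_contra! h
    refine hcon (Set.mem_iUnion.2 ⟨m, Set.mem_iUnion₂.2 ⟨i, ?_, h⟩⟩)
    rw [hI, Finset.mem_filter, Finset.mem_range]
    omega
  have hBle : ∀ m, ∀ i ∈ I m, μ (B m i) ≤
      ENNReal.ofReal ((1 / 2 ^ m) ^ α / (e m ^ β * e m ^ β)) *
        ENNReal.ofReal ((H b - H a) ^ α) := by
    intro m i hi
    have hi2 : i + 2 ≤ 2 ^ (m + 1) := (Finset.mem_filter.1 hi).2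
    have hin : ∀ l : ℕ, l ≤ i + 2 → (l : ℝ) / 2 ^ (m + 1) ∈ Set.Icc (0 : ℝ) 1 := fun l hl =>
      ⟨by positivity, (div_le_one (by positivity)).2 (by exact_mod_cast hl.trans hi2)⟩
    have hord : ∀ l l' : ℕ, l ≤ l' → l' ≤ i + 2 →
        q (l / 2 ^ (m + 1)) ≤ q (l' / 2 ^ (m + 1)) := by
      intro l l' hl hl'
      refine hH.le_iff_le.1 ?_
      rw [hq _ (hin l (hl.trans hl')), hq _ (hin l' hl')]
      have : (l : ℝ) ≤ l' := by exact_mod_cast hl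
      gcongr
    have hc0 : 0 < e m ^ β * e m ^ β := by have := Real.rpow_pos_of_pos (he m) β; positivity
    set g : Ω → ENNReal := fun ω => ENNReal.ofReal
      (|X ω (q ((i + 1 : ℕ) / 2 ^ (m + 1))) - X ω (q (i / 2 ^ (m + 1)))| ^ β *
       |X ω (q ((i + 2 : ℕ) / 2 ^ (m + 1))) - X ω (q ((i + 1 : ℕ) / 2 ^ (m + 1)))| ^ β) with hg
    have hgm : Measurable g := ((((hXm _).sub (hXm _)).abs.pow_const β).mul
      (((hXm _).sub (hXm _)).abs.pow_const β)).ennreal_ofReal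
    have hsubg : B m i ⊆ {ω | ENNReal.ofReal (e m ^ β * e m ^ β) ≤ g ω} := by
      intro ω hω
      refine ENNReal.ofReal_le_ofReal ?_
      have h1 := Real.rpow_le_rpow (he m).le hω.1.le hβ.le
      have h2 := Real.rpow_le_rpow (he m).le hω.2.le hβ.le
      have := Real.rpow_pos_of_pos (he m) β
      gcongr
    -- Two adjacent steps of level `m + 1` make one step of level `m`.
    have hdiff : H (q ((i + 2 : ℕ) / 2 ^ (m + 1))) - H (q (i / 2 ^ (m + 1)))
        = 1 / 2 ^ m * (H b - H a) := by
      rw [hq _ (hin _ le_rfl), hq _ (hin i (by omega))]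
      push_cast
      rw [pow_succ]
      field_simp
      ring
    calc μ (B m i) ≤ μ {ω | ENNReal.ofReal (e m ^ β * e m ^ β) ≤ g ω} := measure_mono hsubg
      _ ≤ (∫⁻ ω, g ω ∂μ) / ENNReal.ofReal (e m ^ β * e m ^ β) :=
        meas_ge_le_lintegral_div hgm.aemeasurable (ENNReal.ofReal_pos.2 hc0).ne'
          ENNReal.ofReal_ne_top
      _ ≤ ENNReal.ofReal ((1 / 2 ^ m * (H b - H a)) ^ α) /
          ENNReal.ofReal (e m ^ β * e m ^ β) := by
        rw [← hdiff]
        gcongr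
        exact hmom _ _ _ (hord i (i + 1) (by omega) (by omega))
          (hord (i + 1) (i + 2) (by omega) le_rfl)
      _ = _ := by
        rw [← ENNReal.ofReal_div_of_pos hc0, Real.mul_rpow (by positivity) hpos.le,
          ← ENNReal.ofReal_mul (by positivity)]
        congr 1; ring
  calc μ {ω | ¬ SmallTripleOsc (X ω) a b ε} ≤ μ (⋃ m, ⋃ i ∈ I m, B m i) := measure_mono hsub
    _ ≤ ∑' m, μ (⋃ i ∈ I m, B m i) := measure_iUnion_le _
    _ ≤ ∑' m, ENNReal.ofReal (2 ^ (m + 1) * ((1 / 2 ^ m) ^ α / (e m ^ β * e m ^ β))) *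
          ENNReal.ofReal ((H b - H a) ^ α) := by
      refine ENNReal.tsum_le_tsum fun m => ?_
      refine (measure_biUnion_finset_le _ _).trans ((Finset.sum_le_card_nsmul _ _ _
        (hBle m)).trans ?_)
      rw [nsmul_eq_mul, ENNReal.ofReal_mul (by positivity), mul_assoc]
      gcongr
      have : (I m).card ≤ 2 ^ (m + 1) :=
        (Finset.card_filter_le _ _).trans (Finset.card_range _).le
      rw [ENNReal.ofReal_pow zero_le_two, ENNReal.ofReal_ofNat]
      exact_mod_cast this
    _ = _ := by rw [ENNReal.tsum_mul_right, chainConst]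

/-! ### Comparison of integrals and truncation -/

theorem MeasureTheory.TendstoInDistribution.tendsto_integral {ι E Ω' : Type*} {Ω : ι → Type*}
    [∀ i, MeasurableSpace (Ω i)] [MeasurableSpace Ω'] [TopologicalSpace E] [MeasurableSpace E]
    [OpensMeasurableSpace E] {l : Filter ι} {μ : ∀ i, Measure (Ω i)}
    [∀ i, IsProbabilityMeasure (μ i)] {μ' : Measure Ω'} [IsProbabilityMeasure μ']
    {X : ∀ i, Ω i → E} {Z : Ω' → E} (h : TendstoInDistribution X l Z μ μ')
    (f : BoundedContinuousFunction E ℝ) :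
    Tendsto (fun i => ∫ ω, f (X i ω) ∂(μ i)) l (𝓝 (∫ ω, f (Z ω) ∂μ')) := by
  have h1 := ProbabilityMeasure.tendsto_iff_forall_integral_tendsto.1 h.tendsto f
  have hm : ∀ ν : Measure E, AEStronglyMeasurable f ν := fun ν =>
    f.continuous.measurable.aestronglyMeasurable
  simp only [ProbabilityMeasure.coe_mk] at h1
  rw [integral_map h.aemeasurable_limit (hm _)] at h1
  refine h1.congr fun i => ?_
  rw [integral_map (h.forall_aemeasurable i) (hm _)]

theorem abs_integral_sub_le_of_le_off {Ω : Type*} [MeasurableSpace Ω] {μ : Measure Ω}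
    [IsProbabilityMeasure μ] {u v : Ω → ℝ} (hu : Integrable u μ) (hv : Integrable v μ) {c C : ℝ}
    (hc : 0 ≤ c) (hC : ∀ ω, |u ω - v ω| ≤ C) {B : Set Ω} (hB : ∀ ω ∉ B, |u ω - v ω| ≤ c) :
    |∫ ω, u ω ∂μ - ∫ ω, v ω ∂μ| ≤ c + C * μ.real B := by
  -- `B` is not assumed measurable, since the oscillation events quantify over uncountably many
  -- times; its measurable hull has the same measure.
  have hBm : MeasurableSet (toMeasurable μ B) := measurableSet_toMeasurable μ B
  have hint : Integrable ((toMeasurable μ B).indicator fun _ => C) μ :=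
    (integrable_const C).indicator hBm
  rw [← integral_sub hu hv]
  calc |∫ ω, (u ω - v ω) ∂μ| ≤ ∫ ω, |u ω - v ω| ∂μ := abs_integral_le_integral_abs
    _ ≤ ∫ ω, (c + (toMeasurable μ B).indicator (fun _ => C) ω) ∂μ := by
      refine integral_mono (hu.sub hv).abs ((integrable_const c).add hint) fun ω => ?_
      by_cases hω : ω ∈ toMeasurable μ B
      · simp only [Set.indicator_of_mem hω]
        linarith [hC ω]
      · simp only [Set.indicator_of_notMem hω, add_zero]
        exact hB ω fun h => hω (subset_toMeasurable μ B h)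
    _ = c + C * μ.real B := by
      rw [integral_add (integrable_const c) hint, integral_indicator_const C hBm, integral_const,
        measureReal_def, measureReal_def, measure_toMeasurable]
      simp [measureReal_def, mul_comm]

/-- The bounded continuous function `y ↦ min 1 (|y| / ε)`. -/
noncomputable def truncAbs (ε : ℝ) : BoundedContinuousFunction ℝ ℝ :=
  BoundedContinuousFunction.ofNormedAddCommGroup (fun y => min 1 |y / ε|) (by fun_prop) 1
    fun y => by
      rw [Real.norm_of_nonneg (le_min zero_le_one (abs_nonneg _))]; exact min_le_left _ _

theorem truncAbs_apply (ε y : ℝ) : truncAbs ε y = min 1 |y / ε| := rfl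

/-- Replaces the indicator of `ε < |Y|` by a continuous function, to which convergence in
distribution applies. -/
theorem measureReal_le_integral_truncAbs {Ω : Type*} [MeasurableSpace Ω] {μ : Measure Ω}
    [IsFiniteMeasure μ] {Y : Ω → ℝ} (hY : Measurable Y) {ε : ℝ} (hε : 0 < ε) :
    μ.real {ω | ε < |Y ω|} ≤ ∫ ω, truncAbs ε (Y ω) ∂μ := by
  have hm : MeasurableSet {ω | ε < |Y ω|} := measurableSet_lt measurable_const hY.abs
  rw [← integral_indicator_one hm]
  refine integral_mono ((integrable_const (1 : ℝ)).indicator hm)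
    (((truncAbs ε).integrable (μ.map Y)).comp_measurable hY) fun ω => ?_
  by_cases hω : ω ∈ {ω | ε < |Y ω|}
  · rw [Set.indicator_of_mem hω, truncAbs_apply, min_eq_left]
    · simp
    · rw [abs_div, abs_of_pos hε]
      exact (one_le_div hε).2 (le_of_lt hω)
  · rw [Set.indicator_of_notMem hω, truncAbs_apply]
    exact le_min zero_le_one (abs_nonneg _)

/-! ### Discretization error in mean -/

/-- With `H`-increments `d ≤ w` one has `d ^ α ≤ w ^ (α - 1) * d`, and the `d` telescope. The
positive power of `w` makes the bound vanish with the mesh. -/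
theorem measure_exists_not_smallTripleOsc_le {Ω : Type*} [MeasurableSpace Ω] (μ : Measure Ω)
    {X : Ω → Cadlag} (hX : Measurable X) {α β : ℝ} (hα : 1 < α) (hβ : 0 < β)
    {H : unitInterval → ℝ} (hH : StrictMono H) (hc : Continuous H)
    (hmom : ∀ r s t : unitInterval, r ≤ s → s ≤ t →
      ∫⁻ ω, ENNReal.ofReal (|X ω s - X ω r| ^ β * |X ω t - X ω s| ^ β) ∂μ
        ≤ ENNReal.ofReal ((H t - H r) ^ α))
    {e : ℕ → ℝ} (he : ∀ m, 0 < e m) {ε : ℝ} (hsum : ∀ m, 2 * ∑ p ∈ Finset.range m, e p ≤ ε)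
    {k : ℕ} (σ : TimeGrid k) {w : ℝ}
    (hw : ∀ i < k, H (σ.pts (i + 1)) - H (σ.pts i) ≤ w) :
    μ {ω | ∃ i < k, ¬ SmallTripleOsc (X ω) (σ.pts i) (σ.pts (i + 1)) ε} ≤
      chainConst α β e * ENNReal.ofReal (w ^ (α - 1) * (H 1 - H 0)) := by
  have hinc : ∀ i < k, 0 < H (σ.pts (i + 1)) - H (σ.pts i) := fun i hi =>
    sub_pos.2 (hH (σ.lt_succ i hi))
  calc μ {ω | ∃ i < k, ¬ SmallTripleOsc (X ω) (σ.pts i) (σ.pts (i + 1)) ε}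
      ≤ μ (⋃ i ∈ Finset.range k, {ω | ¬ SmallTripleOsc (X ω) (σ.pts i) (σ.pts (i + 1)) ε}) := by
        refine measure_mono ?_
        rintro ω ⟨i, hi, h⟩
        exact Set.mem_iUnion₂.2 ⟨i, Finset.mem_range.2 hi, h⟩
    _ ≤ ∑ i ∈ Finset.range k, μ {ω | ¬ SmallTripleOsc (X ω) (σ.pts i) (σ.pts (i + 1)) ε} :=
        measure_biUnion_finset_le _ _
    _ ≤ ∑ i ∈ Finset.range k, chainConst α β e *
          ENNReal.ofReal (w ^ (α - 1) * (H (σ.pts (i + 1)) - H (σ.pts i))) := by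
        refine Finset.sum_le_sum fun i hi => ?_
        have hi' := Finset.mem_range.1 hi
        refine (measure_not_smallTripleOsc_le μ hX hβ hH hc hmom he hsum
          (σ.lt_succ i hi')).trans ?_
        have hpos := hinc i hi'
        gcongr
        set d := H (σ.pts (i + 1)) - H (σ.pts i)
        calc d ^ α = d ^ (α - 1) * d := by
              nth_rewrite 3 [← Real.rpow_one d]
              rw [← Real.rpow_add hpos]; congr 1; ring
          _ ≤ w ^ (α - 1) * d := by
              gcongr
              exact hw i hi'
    _ = _ := by
        rw [← Finset.mul_sum, ← ENNReal.ofReal_sum_of_nonneg, ← Finset.mul_sum,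
          Finset.sum_range_sub (fun i => H (σ.pts i)) k, σ.last, σ.zero]
        intro i hi
        have h1 := hinc i (Finset.mem_range.1 hi)
        have h2 := Real.rpow_nonneg (h1.le.trans (hw i (Finset.mem_range.1 hi))) (α - 1)
        positivity

theorem TimeGrid.measurable_discretize {k : ℕ} (σ : TimeGrid k) :
    Measurable σ.discretize :=
  σ.continuous_stepVec.measurable.comp
    (measurable_pi_lambda _ fun i => Cadlag.measurable_eval (σ.pts i))

/-- Replacing a random càdlàg function by its discretization changes the integral of a bounded
Lipschitz function by little. -/
theorem abs_integral_sub_integral_discretize_le {Ω : Type*} [MeasurableSpace Ω] (μ : Measure Ω)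
    [IsProbabilityMeasure μ] {X : Ω → Cadlag} (hX : Measurable X) {α β : ℝ} (hα : 1 < α)
    (hβ : 0 < β) {H : unitInterval → ℝ} (hH : StrictMono H) (hc : Continuous H)
    (hmom : ∀ r s t : unitInterval, r ≤ s → s ≤ t →
      ∫⁻ ω, ENNReal.ofReal (|X ω s - X ω r| ^ β * |X ω t - X ω s| ^ β) ∂μ
        ≤ ENNReal.ofReal ((H t - H r) ^ α))
    {e : ℕ → ℝ} (he : ∀ m, 0 < e m) {ε : ℝ} (hε : 0 < ε)
    (hsum : ∀ m, 2 * ∑ p ∈ Finset.range m, e p ≤ ε) (hK : chainConst α β e ≠ ⊤)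
    {k : ℕ} (σ : TimeGrid (k + 1)) (hσ : σ.MeshLE ε) {w : ℝ}
    (hw : ∀ i < k + 1, H (σ.pts (i + 1)) - H (σ.pts i) ≤ w)
    (f : BoundedContinuousFunction Cadlag ℝ) {C : ℝ} (hC : ∀ x y, dist (f x) (f y) ≤ C)
    {L : NNReal} (hL : LipschitzWith L f) :
    |∫ ω, f (X ω) ∂μ - ∫ ω, f (σ.discretize (X ω)) ∂μ| ≤ L * (2 * ε) +
      C * ((chainConst α β e).toReal * (w ^ (α - 1) * (H 1 - H 0)) +
        ∫ ω, truncAbs ε (X ω 1 - X ω (σ.pts k)) ∂μ) := by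
  have hXm : ∀ t, Measurable fun ω => X ω t := fun t => (Cadlag.measurable_eval t).comp hX
  set B₁ : Set Ω := {ω | ∃ i < k + 1, ¬ SmallTripleOsc (X ω) (σ.pts i) (σ.pts (i + 1)) ε} with hB₁
  set B₂ : Set Ω := {ω | ε < |X ω 1 - X ω (σ.pts k)|} with hB₂
  have hC0 : 0 ≤ C := dist_nonneg.trans (hC (σ.step 0) (σ.step 0))
  have hw0 : 0 ≤ w := (sub_pos.2 (hH (σ.lt_succ 0 (Nat.succ_pos k)))).le.trans
    (hw 0 (Nat.succ_pos k))
  have hH01 : 0 ≤ H 1 - H 0 := sub_nonneg.2 (hH.monotone zero_le_one)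
  have h1 : μ.real B₁ ≤ (chainConst α β e).toReal * (w ^ (α - 1) * (H 1 - H 0)) := by
    have := ENNReal.toReal_mono (ENNReal.mul_ne_top hK ENNReal.ofReal_ne_top)
      (measure_exists_not_smallTripleOsc_le μ hX hα hβ hH hc hmom he hsum σ hw)
    rwa [ENNReal.toReal_mul, ENNReal.toReal_ofReal
      (mul_nonneg (Real.rpow_nonneg hw0 _) hH01)] at this
  have h2 : μ.real B₂ ≤ ∫ ω, truncAbs ε (X ω 1 - X ω (σ.pts k)) ∂μ :=
    measureReal_le_integral_truncAbs ((hXm 1).sub (hXm _)) hε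
  have hmain := abs_integral_sub_le_of_le_off (μ := μ) (u := fun ω => f (X ω))
    (v := fun ω => f (σ.discretize (X ω))) (c := L * (2 * ε)) (C := C) (B := B₁ ∪ B₂)
    ((f.integrable (μ.map X)).comp_measurable hX)
    ((f.integrable (μ.map fun ω => σ.discretize (X ω))).comp_measurable
      (σ.measurable_discretize.comp hX))
    (by positivity) (fun ω => hC _ _) ?_
  · refine hmain.trans ?_
    have := measureReal_union_le (μ := μ) B₁ B₂
    gcongr
    linarith
  · intro ω hω
    rw [Set.mem_union, not_or] at hω
    have g1 : ∀ i < k + 1, SmallTripleOsc (X ω) (σ.pts i) (σ.pts (i + 1)) ε := by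
      intro i hi
      by_contra h
      exact hω.1 ⟨i, hi, h⟩
    have g2 : |X ω 1 - X ω (σ.pts k)| ≤ ε := not_lt.1 hω.2
    -- On the last interval, apply the triple bound to `σ.pts k ≤ u ≤ 1`: if the second increment is
    -- the small one, `u` is compared with `σ.pts k` through the value at `1`.
    have hd := (X ω).dist_discretize_le σ hε hσ g1 fun u hu hu1 => by
      rcases g1 k (Nat.lt_succ_self k) (σ.pts k) u 1 le_rfl hu hu1.le σ.last.ge with h | h
      · linarith
      · have a1 := abs_le.1 g2
        have a2 := abs_le.1 h
        exact abs_le.2 ⟨by linarith, by linarith⟩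
    rw [max_self, dist_comm] at hd
    exact (hL.dist_le_mul _ _).trans (by gcongr)

theorem exists_rpow_mul_lt {p c η : ℝ} (hp : 0 < p) (hη : 0 < η) :
    ∃ w > 0, w ^ p * c < η := by
  have h : Tendsto (fun w : ℝ => w ^ p * c) (𝓝[>] 0) (𝓝 (0 ^ p * c)) :=
    (((Real.continuous_rpow_const hp.le).tendsto 0).mono_left nhdsWithin_le_nhds).mul_const c
  rw [Real.zero_rpow hp.ne', zero_mul] at h
  obtain ⟨w, hw, hw0⟩ := ((h.eventually (gt_mem_nhds hη)).and self_mem_nhdsWithin).exists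
  exact ⟨w, hw0, hw⟩

/-! ### The convergence theorem -/

theorem theorem13p5 {Ω : ℕ → Type*} {Ω' : Type*} [∀ n, MeasurableSpace (Ω n)]
    [MeasurableSpace Ω'] (μ : ∀ n, Measure (Ω n)) [∀ n, IsProbabilityMeasure (μ n)]
    (μ' : Measure Ω') [IsProbabilityMeasure μ']
    (X : ∀ n, Ω n → Cadlag) (hX : ∀ n, Measurable (X n))
    (Z : Ω' → Cadlag) (hZ : Measurable Z)
    (h_fdd : ∀ (k : ℕ) (t : Fin k → unitInterval),
      (∀ i, t i ∈ Cadlag.contTimes (μ'.map Z)) →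
      TendstoInDistribution (fun n ω i => X n ω (t i)) atTop (fun ω i => Z ω (t i)) μ μ')
    (h_end : TendstoInDistribution
      (fun (δ : unitInterval) ω => Z ω 1 - Z ω (unitInterval.symm δ))
      (𝓝[>] 0) (fun _ : Ω' => (0 : ℝ)) (fun _ => μ') μ')
    (h_moment : ∃ (α β : ℝ) (H : unitInterval → ℝ),
      1 < α ∧ 0 < β ∧ Monotone H ∧ Continuous H ∧
      ∀ (n : ℕ) (r s t : unitInterval), r ≤ s → s ≤ t →
        ∫⁻ ω, ENNReal.ofReal (|X n ω s - X n ω r| ^ β * |X n ω t - X n ω s| ^ β) ∂(μ n)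
          ≤ ENNReal.ofReal ((H t - H r) ^ α)) :
    TendstoInDistribution X atTop Z μ μ' := by
  obtain ⟨α, β, H₀, hα, hβ, hH₀, hc₀, hmom₀⟩ := h_moment
  obtain ⟨H, hH, hc, hmom⟩ : ∃ H : unitInterval → ℝ, StrictMono H ∧ Continuous H ∧
      ∀ (n : ℕ) (r s t : unitInterval), r ≤ s → s ≤ t →
        ∫⁻ ω, ENNReal.ofReal (|X n ω s - X n ω r| ^ β * |X n ω t - X n ω s| ^ β) ∂(μ n)
          ≤ ENNReal.ofReal ((H t - H r) ^ α) := by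
    -- Adding the identity makes `H` strictly increasing, as the time scale requires, and only
    -- enlarges the moment bound.
    refine ⟨fun t => H₀ t + t, fun r t hrt => add_lt_add_of_le_of_lt (hH₀ hrt.le) hrt,
      hc₀.add continuous_subtype_val, fun n r s t hrs hst => (hmom₀ n r s t hrs hst).trans ?_⟩
    refine ENNReal.ofReal_le_ofReal (Real.rpow_le_rpow
      (sub_nonneg.2 (hH₀ (hrs.trans hst))) ?_ (by linarith))
    have : (r : ℝ) ≤ t := hrs.trans hst
    linarith
  have : IsProbabilityMeasure (μ'.map Z) := Measure.isProbabilityMeasure_map hZ.aemeasurable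
  choose σ hσT hσmesh using TimeGrid.exists_meshLE (Cadlag.zero_mem_contTimes (μ'.map Z))
    (Cadlag.one_mem_contTimes _) fun _ _ => Cadlag.exists_mem_contTimes (μ'.map Z)
  have hmesh0 : Tendsto (fun m : ℕ => (2 : ℝ) / (m + 1)) atTop (𝓝 0) :=
    tendsto_const_nhds.div_atTop
      (tendsto_atTop_add_const_right _ _ tendsto_natCast_atTop_atTop)
  refine ⟨fun n => (hX n).aemeasurable, hZ.aemeasurable, ?_⟩
  refine tendsto_iff_forall_lipschitz_integral_tendsto.2 ?_
  rintro f₀ ⟨C, hC⟩ ⟨L, hL⟩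
  obtain ⟨f, rfl⟩ : ∃ f : BoundedContinuousFunction Cadlag ℝ, ⇑f = f₀ :=
    ⟨BoundedContinuousFunction.mkOfBound ⟨f₀, hL.continuous⟩ C hC, rfl⟩
  have hfm : ∀ ν : Measure Cadlag, AEStronglyMeasurable f ν := fun ν =>
    f.continuous.measurable.aestronglyMeasurable
  simp only [ProbabilityMeasure.coe_mk]
  rw [integral_map hZ.aemeasurable (hfm _)]
  simp only [integral_map (hX _).aemeasurable (hfm _)]
  rw [Metric.tendsto_nhds]
  intro η hη
  -- Five errors below or equal to `η / 8` will be added. The constant `K` depends on `ε` but not on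
  -- the grid or on `n`, so `w` and then the grid index `m` can be chosen after it.
  set ε : ℝ := η / (16 * (L + 1)) with hεdef
  have hLp : (0 : ℝ) < L + 1 := by positivity
  have hε : 0 < ε := by positivity
  have hLε : L * (2 * ε) ≤ η / 8 := by
    have : (L + 1) * (2 * ε) = η / 8 := by rw [hεdef]; field_simp; ring
    nlinarith
  obtain ⟨e, he, hsum, hK⟩ := exists_chainConst_ne_top hα hβ hε
  set K : ℝ := (chainConst α β e).toReal with hKdef
  obtain ⟨w, hw0, hw⟩ := exists_rpow_mul_lt (p := α - 1) (c := (H 1 - H 0) * (C * K))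
    (sub_pos.2 hα) (show 0 < η / 8 by positivity)
  obtain ⟨d, hd0, hd⟩ := Metric.uniformContinuous_iff.1
    (CompactSpace.uniformContinuous_of_continuous hc) w hw0
  have hZlim : Tendsto (fun m => ∫ ω, f ((σ m).discretize (Z ω)) ∂μ') atTop
      (𝓝 (∫ ω, f (Z ω) ∂μ')) := by
    refine tendsto_integral_of_dominated_convergence (fun _ => ‖f‖) (fun m => ?_)
      (integrable_const _) (fun m => Eventually.of_forall fun ω => f.norm_coe_le_norm _)
      (Eventually.of_forall fun ω => ?_)
    · exact (f.continuous.measurable.comp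
        ((σ m).measurable_discretize.comp hZ)).aestronglyMeasurable
    · exact (f.continuous.tendsto _).comp ((Z ω).tendsto_discretize σ hσmesh hmesh0)
  have hlast : Tendsto (fun m => unitInterval.symm ((σ m).pts m)) atTop (𝓝[>] 0) := by
    refine tendsto_nhdsWithin_iff.2 ⟨?_, Eventually.of_forall fun m => ?_⟩
    · refine tendsto_subtype_rng.2 (squeeze_zero (fun m => (unitInterval.symm _).2.1)
        (fun m => ?_) hmesh0)
      have := hσmesh m m (Nat.lt_succ_self m)
      rw [(σ m).last] at this
      simpa using this
    · have h1 : (σ m).pts m < 1 := (σ m).last ▸ (σ m).lt_succ m (Nat.lt_succ_self m)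
      change (0 : ℝ) < 1 - (σ m).pts m
      exact sub_pos.2 h1
  have hZend : Tendsto (fun m => ∫ ω, truncAbs ε (Z ω 1 - Z ω ((σ m).pts m)) ∂μ') atTop
      (𝓝 0) := by
    have h1 := (h_end.tendsto_integral (truncAbs ε)).comp hlast
    simpa [truncAbs_apply, Function.comp_def] using h1
  have hCend : Tendsto (fun m => C * ∫ ω, truncAbs ε (Z ω 1 - Z ω ((σ m).pts m)) ∂μ') atTop
      (𝓝 0) := by simpa using hZend.const_mul C
  obtain ⟨m, hm1, hm2, hm3, hm4⟩ := ((hZlim.eventually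
    (Metric.ball_mem_nhds _ (show 0 < η / 8 by positivity))).and
    ((hmesh0.eventually (gt_mem_nhds hε)).and ((hmesh0.eventually (gt_mem_nhds hd0)).and
    (hCend.eventually (gt_mem_nhds (show 0 < η / 8 by positivity)))))).exists
  rw [Real.dist_eq] at hm1
  have hfdd := h_fdd (m + 1 + 1) (fun i => (σ m).pts i) fun i => hσT m i
  -- The discretization is `stepVec` of the vector of grid values, so (i) applies.
  have hstep := ((hfdd.continuous_comp (σ m).continuous_stepVec).tendsto_integral f).eventually
    (Metric.ball_mem_nhds _ (show 0 < η / 8 by positivity))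
  have hendn : ∀ᶠ n in atTop,
      C * ∫ ω, truncAbs ε (X n ω 1 - X n ω ((σ m).pts m)) ∂(μ n) < η / 8 := by
    -- The end condition passes from the limit to `X n` through the joint law at the two times `1`
    -- and `(σ m).pts m`.
    have h2 := h_fdd 2 ![1, (σ m).pts m] (by
      intro i
      fin_cases i
      exacts [Cadlag.one_mem_contTimes _, hσT m m])
    have h3 := (h2.continuous_comp (g := fun y : Fin 2 → ℝ => y 0 - y 1)
      (by fun_prop)).tendsto_integral (truncAbs ε)
    exact (h3.const_mul C).eventually (gt_mem_nhds hm4)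
  filter_upwards [hstep, hendn] with n hn1 hn2
  have hn1' : |∫ ω, f ((σ m).discretize (X n ω)) ∂(μ n) -
      ∫ ω, f ((σ m).discretize (Z ω)) ∂μ'| < η / 8 := hn1
  have hbound := abs_integral_sub_integral_discretize_le (μ n) (hX n) hα hβ hH hc (hmom n) he hε
    hsum hK (σ m) (fun i hi => (hσmesh m i hi).trans hm2.le) (w := w) (fun i hi => ?_) f hC hL
  · rw [mul_add] at hbound
    have hrw : C * ((chainConst α β e).toReal * (w ^ (α - 1) * (H 1 - H 0)))
        = w ^ (α - 1) * ((H 1 - H 0) * (C * K)) := by rw [hKdef]; ring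
    rw [hrw] at hbound
    rw [Real.dist_eq]
    rw [abs_lt] at hn1' hm1
    have := abs_le.1 hbound
    exact abs_lt.2 ⟨by linarith, by linarith⟩
  · have h0 : ((σ m).pts i : ℝ) ≤ (σ m).pts (i + 1) := ((σ m).lt_succ i hi).le
    have h1 : dist ((σ m).pts (i + 1)) ((σ m).pts i) < d := by
      rw [Subtype.dist_eq, Real.dist_eq, abs_of_nonneg (sub_nonneg.2 h0)]
      exact (hσmesh m i hi).trans_lt hm3
    exact (le_abs_self _).trans (hd h1).le
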